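/- Let $n\ge 1$, let $k$ be an algebraically closed field and let $V$ be an $n$-dimensional $k$-vector space. Let $\mathcal F$ be the variety of $n$-step flags $0=V_0\subseteq V_1\subseteq\cdots\subseteq V_n=V$ (repetitions allowed), and let $\mathrm{GL}(V)$ act diagonally on $\mathcal F\times\mathcal F$; write $[f,f']$ for the orbit of $(f,f')$. For orbits $e,e'$ put $S(e,e')=\{(p_1,p_3) : \exists\, p_2\in\mathcal F,\ (p_1,p_2)\in e,\ (p_2,p_3)\in e'\}$. Let $G(n,n)$ be the free $\mathbb Z$-module on the set of orbits with the bilinear product $\star$ for which $e\star e'$ is the unique orbit that is Zariski-open in $S(e,e')$ if $S(e,e')\neq\emptyset$, and $e\star e'=0$ if $S(e,e')=\emptyset$. Let $\underline d=1+\cdots+1$, let $\mathcal F_{\underline d}\subseteq\mathcal F$ be the set of complete flags, let $k_{\underline d}=[h,h]$ for any $h\in\mathcal F_{\underline d}$, and let $H_0(n)=k_{\underline d}\star G(n,n)\star k_{\underline d}$. For $1\le i\le n-1$ let $t_i\in H_0(n)$ be the orbit $[f,f']$, where for a basis $v_1,\dots,v_n$ of $V$ the flag $f'$ is given by $f'_j=\langle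 v_1,\dots,v_j\rangle$ and $f$ by $f_j=\langle v_l : s_i(l)\le j\rangle$, with $s_i=(i,i+1)$. Let $\mathcal H_0(n)$ be the $0$-Hecke algebra: the $\mathbb C$-algebra with generators $\mathcal T_1,\dots,\mathcal T_{n-1}$ and defining relations $\mathcal T_i^2=-\mathcal T_i$, $\mathcal T_i\mathcal T_{i+1}\mathcal T_i=\mathcal T_{i+1}\mathcal T_i\mathcal T_{i+1}$, and $\mathcal T_i\mathcal T_j=\mathcal T_j\mathcal T_i$ for $|i-j|>1$. Theorem. The product of $H_0(n)$ is well defined (for any two orbits $e,e'$ of pairs of complete flags, $S(e,e')$ is non-empty and contains exactly one orbit open in it) and makes $H_0(n)$ an associative ring with unit $k_{\underline d}$, and there is an isomorphism of $\mathbb C$-algebras $$\mathcal H_0(n)\;\xrightarrow{\ \sim\ }\; H_0(n)\otimes_{\mathbb Z}\mathbb C,\qquad \mathcal T_i\longmapsto -t_i\quad(1\le i\le n-1).$$ Thus $H_0(n)$ is a geometric realisation of the $0$-Hecke algebra. -/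

import Mathlib

open scoped TensorProduct Topology

noncomputable section

/-! ### Flags, pairs of flags and their orbits -/

/-- An `n`-step flag `0 = V₀ ⊆ V₁ ⊆ ⋯ ⊆ Vₙ = V`; repetitions are allowed. -/
@[ext]
structure StepFlag (k V : Type*) [Field k] [AddCommGroup V] [Module k V] (n : ℕ) where
  /-- the subspaces `V₀, …, Vₙ` -/
  space : Fin (n + 1) → Submodule k V
  monotone' : Monotone space
  zero' : space 0 = ⊥
  last' : space (Fin.last n) = ⊤

namespace StepFlag

variable {k V : Type*} [Field k] [AddCommGroup V] [Module k V] {n : ℕ}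

/-- The general linear group acts on flags by change of basis. -/
instance : MulAction (LinearMap.GeneralLinearGroup k V) (StepFlag k V n) where
  smul g f :=
    { space := fun i => (f.space i).map (g : V →ₗ[k] V)
      monotone' := fun _ _ h => Submodule.map_mono (f.monotone' h)
      zero' := by rw [f.zero', Submodule.map_bot]
      last' := by
        rw [f.last', Submodule.map_top, LinearMap.range_eq_top]
        exact ((LinearMap.GeneralLinearGroup.generalLinearEquiv k V) g).surjective }
  one_smul f := by
    ext1
    funext i
    exact Submodule.map_id _
  mul_smul g h f := by
    ext1
    funext i
    exact Submodule.map_comp _ _ _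

theorem smul_space (g : LinearMap.GeneralLinearGroup k V) (f : StepFlag k V n) (i : Fin (n + 1)) :
    (g • f).space i = (f.space i).map (g : V →ₗ[k] V) := rfl

/-- The complete flag of a basis `b₀, …, bₙ₋₁`: its `j`-th space is spanned by `b₀, …, bⱼ₋₁`. -/
def ofBasis (b : Module.Basis (Fin n) k V) : StepFlag k V n where
  space := b.flag
  monotone' := b.flag_mono
  zero' := b.flag_zero
  last' := b.flag_last

/-- The flag belongs to the decomposition `d = 1 + ⋯ + 1`: every step has dimension one. -/
def IsComplete (f : StepFlag k V n) : Prop :=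
  ∀ i : Fin n, Module.finrank k (f.space i.succ) = Module.finrank k (f.space i.castSucc) + 1

theorem ofBasis_isComplete (b : Module.Basis (Fin n) k V) : (ofBasis b).IsComplete := by
  have key : ∀ j : Fin (n + 1), Module.finrank k (b.flag j) = j := by
    intro j
    have hr : b '' {i | i.castSucc < j} =
        Set.range (b ∘ Fin.castLE (Nat.lt_succ_iff.1 j.isLt)) := by
      ext x
      simp only [Set.mem_image, Set.mem_range, Function.comp_apply, Set.mem_ofPred_eq]
      constructor
      · rintro ⟨i, hi, rfl⟩
        exact ⟨⟨i, hi⟩, rfl⟩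
      · rintro ⟨i, rfl⟩
        exact ⟨Fin.castLE (Nat.lt_succ_iff.1 j.isLt) i, i.isLt, rfl⟩
    rw [Module.Basis.flag, hr, finrank_span_eq_card
      (b.linearIndependent.comp _ (Fin.castLE_injective _)), Fintype.card_fin]
  intro i
  change Module.finrank k (b.flag _) = Module.finrank k (b.flag _) + 1
  rw [key, key]
  simp

/-- The complete flags of any two bases are conjugate under the general linear group. -/
theorem ofBasis_mem_orbit (b c : Module.Basis (Fin n) k V) :
    ofBasis c ∈ MulAction.orbit (LinearMap.GeneralLinearGroup k V) (ofBasis b) := by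
  refine ⟨LinearMap.GeneralLinearGroup.ofLinearEquiv (b.equiv c (Equiv.refl _)), ?_⟩
  ext1
  funext i
  change (b.flag i).map ((b.equiv c (Equiv.refl _) : V ≃ₗ[k] V) : V →ₗ[k] V) = c.flag i
  rw [Module.Basis.flag, Module.Basis.flag, Submodule.map_span, ← Set.image_comp]
  congr 1
  refine Set.image_congr fun j _ => ?_
  simp

end StepFlag

/-- The set `(𝓕 × 𝓕) / GL(V)` of orbits of pairs of flags. -/
abbrev FlagPairOrbit (k V : Type*) [Field k] [AddCommGroup V] [Module k V] (n : ℕ) : Type _ :=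
  MulAction.orbitRel.Quotient (LinearMap.GeneralLinearGroup k V)
    (StepFlag k V n × StepFlag k V n)

/-- The orbit `[f, f']` of a pair of flags. -/
def pairOrbit {k V : Type*} [Field k] [AddCommGroup V] [Module k V] {n : ℕ}
    (p : StepFlag k V n × StepFlag k V n) : FlagPairOrbit k V n :=
  Quotient.mk'' p

theorem orbit_nonempty {k V : Type*} [Field k] [AddCommGroup V] [Module k V] {n : ℕ}
    (a : FlagPairOrbit k V n) : a.orbit.Nonempty := by
  obtain ⟨p, rfl⟩ := Quotient.exists_rep a
  exact ⟨p, MulAction.mem_orbit_self p⟩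

/-! ### The Zariski topology -/

/-- The Zariski topology on a finite-dimensional vector space `W`: the topology generated by the
principal open sets `{p ≠ 0}`, where `p` is a polynomial in linear forms on `W`. -/
@[reducible]
def zariskiTopology (k W : Type*) [Field k] [AddCommGroup W] [Module k W] : TopologicalSpace W :=
  TopologicalSpace.generateFrom (Set.range fun p : MvPolynomial (Module.Dual k W) k =>
    {x : W | MvPolynomial.eval (fun l : Module.Dual k W => l x) p ≠ 0})

/-- The Zariski topology on the variety `GL(V) × GL(V)`, as a subspace of the vector space
`End(V) × End(V)`. -/
@[reducible]
def zariskiGLGL (k V : Type*) [Field k] [AddCommGroup V] [Module k V] :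
    TopologicalSpace (LinearMap.GeneralLinearGroup k V × LinearMap.GeneralLinearGroup k V) :=
  TopologicalSpace.induced
    (fun g => ((g.1 : Module.End k V), (g.2 : Module.End k V)))
    (zariskiTopology k (Module.End k V × Module.End k V))

/-- The Zariski topology on the variety `𝓕 × 𝓕`. This variety is the disjoint union of the
homogeneous spaces `GL(V) f × GL(V) f' = (GL(V) × GL(V)) / (P × P')`, where `P` and `P'` are the
stabilisers of `f` and `f'`, each with the quotient topology: a set is open if and only if its
preimage under every orbit map `(g, h) ↦ (g f, h f')` is open in `GL(V) × GL(V)`. -/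
@[reducible]
def zariskiFlagPairs (k V : Type*) [Field k] [AddCommGroup V] [Module k V] (n : ℕ) :
    TopologicalSpace (StepFlag k V n × StepFlag k V n) :=
  ⨆ p : StepFlag k V n × StepFlag k V n,
    TopologicalSpace.coinduced (fun g => (g.1 • p.1, g.2 • p.2)) (zariskiGLGL k V)

/-! ### The generic algebra `G(n, r)`, `r = dim V` -/

section Generic

variable {k V : Type*} [Field k] [AddCommGroup V] [Module k V] {n : ℕ}

/-- `S(A, A') = π (Δ⁻¹ (e_A × e_A'))`. -/
def orbitProduct (a a' : FlagPairOrbit k V n) : Set (StepFlag k V n × StepFlag k V n) :=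
  {p | ∃ f : StepFlag k V n, (p.1, f) ∈ a.orbit ∧ (f, p.2) ∈ a'.orbit}

/-- The orbit `c` is contained in `S` and is open in `S` for the subspace topology. -/
def IsOpenOrbitIn (c : FlagPairOrbit k V n) (S : Set (StepFlag k V n × StepFlag k V n)) : Prop :=
  ∃ U, IsOpen[zariskiFlagPairs k V n] U ∧ c.orbit = U ∩ S

variable (k V n) in
/-- The generic algebra: the free `ℤ`-module on the orbits of pairs of flags. -/
def GenericAlgebra : Type _ := FlagPairOrbit k V n →₀ ℤ

instance : AddCommGroup (GenericAlgebra k V n) :=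
  inferInstanceAs (AddCommGroup (FlagPairOrbit k V n →₀ ℤ))

/-- The basis element of `G(n, r)` given by an orbit. -/
def basisElt (a : FlagPairOrbit k V n) : GenericAlgebra k V n := Finsupp.single a (1 : ℤ)

open Classical in
/-- The product `e_A ⋆ e_A'` of two basis elements: the unique open orbit in `S(A, A')`, and `0`
if `S(A, A')` is empty. -/
def starBasis (a a' : FlagPairOrbit k V n) : GenericAlgebra k V n :=
  if h : (orbitProduct a a').Nonempty ∧ ∃! c, IsOpenOrbitIn c (orbitProduct a a') then
    basisElt h.2.choose
  else 0

/-- The bilinear extension of `starBasis`. -/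
def starBilin : GenericAlgebra k V n →ₗ[ℤ] GenericAlgebra k V n →ₗ[ℤ] GenericAlgebra k V n :=
  Finsupp.linearCombination ℤ (M := GenericAlgebra k V n →ₗ[ℤ] GenericAlgebra k V n)
    fun a : FlagPairOrbit k V n =>
      Finsupp.linearCombination ℤ (M := GenericAlgebra k V n)
        fun a' : FlagPairOrbit k V n => starBasis a a'

/-- `G(n, r)` with the product `⋆`. -/
instance : NonUnitalNonAssocRing (GenericAlgebra k V n) :=
  { (inferInstance : AddCommGroup (GenericAlgebra k V n)) with
    mul := fun x y => starBilin x y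
    left_distrib := fun x y z => map_add (starBilin x) y z
    right_distrib := fun x y z => LinearMap.map_add₂ starBilin x y z
    zero_mul := fun x => LinearMap.map_zero₂ starBilin x
    mul_zero := fun x => map_zero (starBilin x) }

theorem GenericAlgebra.mul_def (x y : GenericAlgebra k V n) : x * y = starBilin x y := rfl

theorem basisElt_mul (a a' : FlagPairOrbit k V n) :
    basisElt a * basisElt a' = starBasis a a' := by
  rw [GenericAlgebra.mul_def, starBilin, basisElt, basisElt]
  erw [Finsupp.linearCombination_single, one_smul, Finsupp.linearCombination_single, one_smul]

theorem basisElt_mul_cases (a a' : FlagPairOrbit k V n) :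
    basisElt a * basisElt a' = 0 ∨
      ∃ c : FlagPairOrbit k V n, c.orbit ⊆ orbitProduct a a' ∧
        basisElt a * basisElt a' = basisElt c := by
  rw [basisElt_mul, starBasis]
  split_ifs with h
  · obtain ⟨U, -, hU⟩ := h.2.choose_spec.1
    exact Or.inr ⟨_, hU ▸ Set.inter_subset_right, rfl⟩
  · exact Or.inl rfl

theorem basisElt_mul_eq {a a' c : FlagPairOrbit k V n} (h : orbitProduct a a' = c.orbit) :
    basisElt a * basisElt a' = basisElt c := by
  have key : ∀ z : FlagPairOrbit k V n, IsOpenOrbitIn z (orbitProduct a a') ↔ z = c := by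
    intro z
    constructor
    · rintro ⟨U, -, hU⟩
      have hz : z.orbit ⊆ c.orbit := by
        rw [hU, h]
        exact Set.inter_subset_right
      obtain ⟨p, hp⟩ : z.orbit.Nonempty := orbit_nonempty z
      have h1 := MulAction.orbitRel.Quotient.mem_orbit.1 hp
      have h2 := MulAction.orbitRel.Quotient.mem_orbit.1 (hz hp)
      exact h1.symm.trans h2
    · rintro rfl
      exact ⟨Set.univ, @isOpen_univ _ (zariskiFlagPairs k V n), by rw [h, Set.univ_inter]⟩
  have hn : (orbitProduct a a').Nonempty :=
    h ▸ orbit_nonempty c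
  have hu : ∃! z, IsOpenOrbitIn z (orbitProduct a a') := ⟨c, (key c).2 rfl, fun z => (key z).1⟩
  rw [basisElt_mul, starBasis, dif_pos ⟨hn, hu⟩, (key _).1 hu.choose_spec.1]

theorem basisElt_mul_eq_zero {a a' : FlagPairOrbit k V n} (h : orbitProduct a a' = ∅) :
    basisElt a * basisElt a' = 0 := by
  rw [basisElt_mul, starBasis, dif_neg]
  rintro ⟨h1, -⟩
  exact h1.ne_empty h

/-- The idempotent `k_d = [f, f]`, where `d` is the decomposition of the flag `f`. -/
def idemElt (f : StepFlag k V n) : GenericAlgebra k V n := basisElt (pairOrbit (f, f))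

theorem mem_orbit_pairOrbit {p q : StepFlag k V n × StepFlag k V n} :
    p ∈ (pairOrbit q).orbit ↔ ∃ g : LinearMap.GeneralLinearGroup k V, g • q.1 = p.1 ∧
      g • q.2 = p.2 := by
  rw [pairOrbit, MulAction.orbitRel.Quotient.orbit_mk]
  constructor
  · rintro ⟨g, rfl⟩
    exact ⟨g, rfl, rfl⟩
  · rintro ⟨g, h1, h2⟩
    exact ⟨g, Prod.ext h1 h2⟩

theorem idemElt_mul_basisElt (f : StepFlag k V n) (p : StepFlag k V n × StepFlag k V n)
    (h : p.1 ∈ MulAction.orbit (LinearMap.GeneralLinearGroup k V) f) :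
    idemElt f * basisElt (pairOrbit p) = basisElt (pairOrbit p) := by
  refine basisElt_mul_eq (Set.ext fun q => ?_)
  simp only [orbitProduct, Set.mem_ofPred_eq, mem_orbit_pairOrbit]
  constructor
  · rintro ⟨f', ⟨g, h1, h2⟩, g', h3, h4⟩
    exact ⟨g', h3.trans (h2.symm.trans h1), h4⟩
  · rintro ⟨g, h1, h2⟩
    obtain ⟨g', hg'⟩ := h
    exact ⟨q.1, ⟨g * g', by rw [mul_smul]; exact (congrArg (g • ·) hg').trans h1,
      by rw [mul_smul]; exact (congrArg (g • ·) hg').trans h1⟩, g, h1, h2⟩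

theorem idemElt_mul_basisElt_zero (f : StepFlag k V n) (p : StepFlag k V n × StepFlag k V n)
    (h : p.1 ∉ MulAction.orbit (LinearMap.GeneralLinearGroup k V) f) :
    idemElt f * basisElt (pairOrbit p) = 0 := by
  refine basisElt_mul_eq_zero (Set.eq_empty_iff_forall_notMem.2 fun q => ?_)
  simp only [orbitProduct, Set.mem_ofPred_eq, mem_orbit_pairOrbit]
  rintro ⟨f', ⟨g, h1, h2⟩, g', h3, h4⟩
  refine h ⟨g'⁻¹ * g, ?_⟩
  change (g'⁻¹ * g) • f = p.1
  rw [mul_smul, h2, ← h3, inv_smul_smul]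

theorem basisElt_mul_idemElt (f : StepFlag k V n) (p : StepFlag k V n × StepFlag k V n)
    (h : p.2 ∈ MulAction.orbit (LinearMap.GeneralLinearGroup k V) f) :
    basisElt (pairOrbit p) * idemElt f = basisElt (pairOrbit p) := by
  refine basisElt_mul_eq (Set.ext fun q => ?_)
  simp only [orbitProduct, Set.mem_ofPred_eq, mem_orbit_pairOrbit]
  constructor
  · rintro ⟨f', ⟨g, h1, h2⟩, g', h3, h4⟩
    exact ⟨g, h1, h2.trans (h3.symm.trans h4)⟩
  · rintro ⟨g, h1, h2⟩
    obtain ⟨g', hg'⟩ := h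
    exact ⟨q.2, ⟨g, h1, h2⟩, g * g', by rw [mul_smul]; exact (congrArg (g • ·) hg').trans h2,
      by rw [mul_smul]; exact (congrArg (g • ·) hg').trans h2⟩

theorem basisElt_mul_idemElt_zero (f : StepFlag k V n) (p : StepFlag k V n × StepFlag k V n)
    (h : p.2 ∉ MulAction.orbit (LinearMap.GeneralLinearGroup k V) f) :
    basisElt (pairOrbit p) * idemElt f = 0 := by
  refine basisElt_mul_eq_zero (Set.eq_empty_iff_forall_notMem.2 fun q => ?_)
  simp only [orbitProduct, Set.mem_ofPred_eq, mem_orbit_pairOrbit]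
  rintro ⟨f', ⟨g, h1, h2⟩, g', h3, h4⟩
  refine h ⟨g⁻¹ * g', ?_⟩
  change (g⁻¹ * g') • f = p.2
  rw [mul_smul, h3, ← h2, inv_smul_smul]

theorem GenericAlgebra.induction {P : GenericAlgebra k V n → Prop} (x : GenericAlgebra k V n)
    (zero : P 0) (add : ∀ x y, P x → P y → P (x + y)) (neg : ∀ x, P x → P (-x))
    (basis : ∀ p : StepFlag k V n × StepFlag k V n, P (basisElt (pairOrbit p))) : P x := by
  have hsmul : ∀ (m : ℤ) (a : FlagPairOrbit k V n), P (m • basisElt a) := by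
    intro m a
    induction a using Quotient.inductionOn' with
    | h p =>
      induction m using Int.induction_on with
      | zero => rw [zero_smul]; exact zero
      | succ i ih => rw [add_smul, one_smul]; exact add _ _ ih (basis p)
      | pred i ih =>
        rw [sub_smul, one_smul, sub_eq_add_neg]
        exact add _ _ ih (neg _ (basis p))
  refine Finsupp.induction_linear (motive := P) x zero add fun a m => ?_
  have : (Finsupp.single a m : FlagPairOrbit k V n →₀ ℤ) =
      (m • Finsupp.single a (1 : ℤ) : FlagPairOrbit k V n →₀ ℤ) := by simp
  rw [this]
  exact hsmul m a

theorem idemElt_mul_assoc (f : StepFlag k V n) (x y : GenericAlgebra k V n) :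
    idemElt f * (x * y) = (idemElt f * x) * y := by
  induction x using GenericAlgebra.induction with
  | zero => simp
  | add x x' h h' => rw [add_mul, mul_add, mul_add, add_mul, h, h']
  | neg x h => rw [neg_mul, mul_neg, mul_neg, neg_mul, h]
  | basis p =>
    induction y using GenericAlgebra.induction with
    | zero => simp
    | add y y' h h' => rw [mul_add, mul_add, mul_add, h, h']
    | neg y h => rw [mul_neg, mul_neg, mul_neg, h]
    | basis q =>
      by_cases hp : p.1 ∈ MulAction.orbit (LinearMap.GeneralLinearGroup k V) f
      · rw [idemElt_mul_basisElt f p hp]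
        rcases basisElt_mul_cases (pairOrbit p) (pairOrbit q) with h | ⟨c, hc, h⟩
        · rw [h, mul_zero]
        · rw [h]
          obtain ⟨s, rfl⟩ := Quotient.exists_rep c
          refine idemElt_mul_basisElt f s ?_
          obtain ⟨f', h1, -⟩ := hc (MulAction.mem_orbit_self s)
          obtain ⟨g, h2, -⟩ := mem_orbit_pairOrbit.1 h1
          obtain ⟨g', hg'⟩ := hp
          exact ⟨g * g', by
            change (g * g') • f = s.1
            rw [mul_smul]; exact (congrArg (g • ·) hg').trans h2⟩
      · rw [idemElt_mul_basisElt_zero f p hp, zero_mul]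
        rcases basisElt_mul_cases (pairOrbit p) (pairOrbit q) with h | ⟨c, hc, h⟩
        · rw [h, mul_zero]
        · rw [h]
          obtain ⟨s, rfl⟩ := Quotient.exists_rep c
          refine idemElt_mul_basisElt_zero f s fun ⟨g', hg'⟩ => hp ?_
          obtain ⟨f', h1, -⟩ := hc (MulAction.mem_orbit_self s)
          obtain ⟨g, h2, -⟩ := mem_orbit_pairOrbit.1 h1
          refine ⟨g⁻¹ * g', ?_⟩
          change g • p.1 = s.1 at h2
          change g' • f = s.1 at hg'
          change (g⁻¹ * g') • f = p.1
          rw [mul_smul, hg', ← h2, inv_smul_smul]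

theorem mul_idemElt_assoc (f : StepFlag k V n) (x y : GenericAlgebra k V n) :
    (x * y) * idemElt f = x * (y * idemElt f) := by
  induction x using GenericAlgebra.induction with
  | zero => simp
  | add x x' h h' => rw [add_mul, add_mul, add_mul, h, h']
  | neg x h => rw [neg_mul, neg_mul, neg_mul, h]
  | basis p =>
    induction y using GenericAlgebra.induction with
    | zero => simp
    | add y y' h h' => rw [mul_add, add_mul, add_mul, mul_add, h, h']
    | neg y h => rw [mul_neg, neg_mul, neg_mul, mul_neg, h]
    | basis q =>
      by_cases hq : q.2 ∈ MulAction.orbit (LinearMap.GeneralLinearGroup k V) f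
      · rw [basisElt_mul_idemElt f q hq]
        rcases basisElt_mul_cases (pairOrbit p) (pairOrbit q) with h | ⟨c, hc, h⟩
        · rw [h, zero_mul]
        · rw [h]
          obtain ⟨s, rfl⟩ := Quotient.exists_rep c
          refine basisElt_mul_idemElt f s ?_
          obtain ⟨f', -, h1⟩ := hc (MulAction.mem_orbit_self s)
          obtain ⟨g, -, h2⟩ := mem_orbit_pairOrbit.1 h1
          obtain ⟨g', hg'⟩ := hq
          exact ⟨g * g', by
            change (g * g') • f = s.2
            rw [mul_smul]; exact (congrArg (g • ·) hg').trans h2⟩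
      · rw [basisElt_mul_idemElt_zero f q hq, mul_zero]
        rcases basisElt_mul_cases (pairOrbit p) (pairOrbit q) with h | ⟨c, hc, h⟩
        · rw [h, zero_mul]
        · rw [h]
          obtain ⟨s, rfl⟩ := Quotient.exists_rep c
          refine basisElt_mul_idemElt_zero f s fun ⟨g', hg'⟩ => hq ?_
          obtain ⟨f', -, h1⟩ := hc (MulAction.mem_orbit_self s)
          obtain ⟨g, -, h2⟩ := mem_orbit_pairOrbit.1 h1
          refine ⟨g⁻¹ * g', ?_⟩
          change g • q.2 = s.2 at h2
          change g' • f = s.2 at hg'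
          change (g⁻¹ * g') • f = q.2
          rw [mul_smul, hg', ← h2, inv_smul_smul]

theorem idemElt_mul_self (f : StepFlag k V n) : idemElt f * idemElt f = idemElt f :=
  idemElt_mul_basisElt f (f, f) (MulAction.mem_orbit_self f)

/-- The corner `k_d G(n, r) k_d`, where `d` is the decomposition of the flag `f`. -/
def corner (f : StepFlag k V n) : NonUnitalSubring (GenericAlgebra k V n) where
  carrier := {x | ∃ y, x = idemElt f * y * idemElt f}
  zero_mem' := ⟨0, by simp⟩
  add_mem' := by
    rintro _ _ ⟨x, rfl⟩ ⟨y, rfl⟩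
    exact ⟨x + y, by rw [mul_add, add_mul]⟩
  neg_mem' := by
    rintro _ ⟨x, rfl⟩
    exact ⟨-x, by rw [mul_neg, neg_mul]⟩
  mul_mem' := by
    rintro _ _ ⟨x, rfl⟩ ⟨y, rfl⟩
    refine ⟨x * idemElt f * (idemElt f * y), ?_⟩
    rw [← mul_idemElt_assoc, mul_idemElt_assoc f (idemElt f) x, ← idemElt_mul_assoc]

theorem idemElt_mem_corner (f : StepFlag k V n) : idemElt f ∈ corner f :=
  ⟨idemElt f, by rw [idemElt_mul_self, idemElt_mul_self]⟩

/-- The corner has the unit element `k_d`. -/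
instance (f : StepFlag k V n) : NonAssocRing (corner f) :=
  { (inferInstance : NonUnitalNonAssocRing (corner f)) with
    one := ⟨idemElt f, idemElt_mem_corner f⟩
    one_mul := by
      rintro ⟨_, x, rfl⟩
      refine Subtype.ext ?_
      change idemElt f * (idemElt f * x * idemElt f) = idemElt f * x * idemElt f
      rw [idemElt_mul_assoc, idemElt_mul_assoc, idemElt_mul_self]
    mul_one := by
      rintro ⟨_, x, rfl⟩
      refine Subtype.ext ?_
      change idemElt f * x * idemElt f * idemElt f = idemElt f * x * idemElt f
      rw [mul_idemElt_assoc, idemElt_mul_self] }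

end Generic

/-! ### The geometric algebra `H₀(n)` -/

section Geometric

variable {k V : Type*} [Field k] [AddCommGroup V] [Module k V] {n : ℕ}

/-- `H₀(n) = k_d G(n, n) k_d` for `d = 1 + ⋯ + 1`; here `dim V = n` and `k_d = [f, f]` for the
complete flag `f` of the basis `b`. -/
def GeomHeckeZero (b : Module.Basis (Fin n) k V) : Type _ := corner (StepFlag.ofBasis b)

instance (b : Module.Basis (Fin n) k V) : NonAssocRing (GeomHeckeZero b) :=
  inferInstanceAs (NonAssocRing (corner (StepFlag.ofBasis b)))

/-- The orbit `σ k_d`, `σ ∈ Sₙ`, of pairs of complete flags `(f, f')` for which there is a basis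
`v` such that `f'` is the flag of `v` and `v l` enters `f` at step `σ l`. It corresponds to the
representation `⨁ N_{σ l, l}`. -/
def permOrbit (b : Module.Basis (Fin n) k V) (σ : Equiv.Perm (Fin n)) : FlagPairOrbit k V n :=
  pairOrbit (StepFlag.ofBasis (b.reindex σ), StepFlag.ofBasis b)

theorem basisElt_permOrbit_mem (b : Module.Basis (Fin n) k V) (σ : Equiv.Perm (Fin n)) :
    basisElt (permOrbit b σ) ∈ corner (StepFlag.ofBasis b) := by
  refine ⟨basisElt (permOrbit b σ), ?_⟩
  rw [permOrbit, idemElt_mul_basisElt _ _ (StepFlag.ofBasis_mem_orbit _ _),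
    basisElt_mul_idemElt _ _ (StepFlag.ofBasis_mem_orbit _ _)]

/-- The element `σ k_d` of `H₀(n)`. -/
def permElt (b : Module.Basis (Fin n) k V) (σ : Equiv.Perm (Fin n)) : GeomHeckeZero b :=
  ⟨basisElt (permOrbit b σ), basisElt_permOrbit_mem b σ⟩

/-- The element `t_i = (i, i + 1) k_d` of `H₀(n)`, for the `n - 1` simple transpositions
(numbered from `0`). -/
def tElt (b : Module.Basis (Fin n) k V) (i : Fin (n - 1)) : GeomHeckeZero b :=
  permElt b (Equiv.swap ⟨i, by omega⟩ ⟨i + 1, by omega⟩)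

/-- `H₀(n)` as a ring, given that its product is associative. -/
abbrev GeomHeckeZero.ring (b : Module.Basis (Fin n) k V)
    (h : ∀ x y z : GeomHeckeZero b, x * y * z = x * (y * z)) : Ring (GeomHeckeZero b) :=
  { (inferInstance : NonAssocRing (GeomHeckeZero b)) with
    mul_assoc := h }

end Geometric

/-! ### The `0`-Hecke algebra by generators and relations -/

/-- The defining relations of the `0`-Hecke algebra on the generators `𝒯_i`, `i < n - 1`. -/
inductive ZeroHeckeRel (n : ℕ) :
    FreeAlgebra ℂ (Fin (n - 1)) → FreeAlgebra ℂ (Fin (n - 1)) → Prop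
  | quad (i : Fin (n - 1)) :
      ZeroHeckeRel n (FreeAlgebra.ι ℂ i * FreeAlgebra.ι ℂ i) (-FreeAlgebra.ι ℂ i)
  | braid (i j : Fin (n - 1)) (h : (j : ℕ) = i + 1) :
      ZeroHeckeRel n (FreeAlgebra.ι ℂ i * FreeAlgebra.ι ℂ j * FreeAlgebra.ι ℂ i)
        (FreeAlgebra.ι ℂ j * FreeAlgebra.ι ℂ i * FreeAlgebra.ι ℂ j)
  | comm (i j : Fin (n - 1)) (h : (i : ℕ) + 1 < j ∨ (j : ℕ) + 1 < i) :
      ZeroHeckeRel n (FreeAlgebra.ι ℂ i * FreeAlgebra.ι ℂ j)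
        (FreeAlgebra.ι ℂ j * FreeAlgebra.ι ℂ i)

/-- The `0`-Hecke algebra `𝓗₀(n)` over `ℂ`. -/
abbrev ZeroHecke (n : ℕ) : Type := RingQuot (ZeroHeckeRel n)

/-- The generator `𝒯_i` of the `0`-Hecke algebra. -/
def ZeroHecke.gen {n : ℕ} (i : Fin (n - 1)) : ZeroHecke n :=
  RingQuot.mkAlgHom ℂ (ZeroHeckeRel n) (FreeAlgebra.ι ℂ i)

end

/-! Fix a basis of V. Pairs of complete flags up to GL(V) are classified by permutations (Bruhat
decomposition, `RelPos.exists_of_isComplete`), and the position σ of (p, q) is recovered from the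
numbers dim(p_a ∩ q_b), which equal `permRank σ a b`. So H₀(n) has a ℤ-basis indexed by Sₙ
(`permBasis`), and the product of two basis elements must be identified.

The open orbit in S(σ, τ) is the one on which all these dimensions are simultaneously minimal; its
permutation m is the Demazure product (`IsDemazureProduct`). It is built by multiplying σ on the
left by simple transpositions that increase the length: each such factor changes m by `demazureStep`
(`IsDemazureProduct.adjSwap_mul`). Minimal dimension is an open condition, since dim(gP ∩ hQ) is
upper semicontinuous, so the orbit of m is open in S (`IsDemazureProduct.isOpenOrbitIn`). It is the
only open one by an irreducibility argument: every orbit in S has a representative (X, γY) with γ in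
a Borel subgroup, and a line joining two elements of that subgroup meets both open sets, because a
nonzero polynomial over an infinite field has a nonroot (`isOpenOrbitIn_unique`).

Hence t_i acts on the left of the basis by `demazureStep i`. The t_i are therefore idempotent and
satisfy the braid and commutation relations, so 𝒯_i ↦ -t_i defines an algebra map, which is onto
because every permutation is an increasing product of simple transpositions. Normal form words show
that the 0-Hecke algebra has dimension at most n!, which is the dimension of the target; so the map
is bijective (`exists_zeroHecke_algEquiv`). Associativity follows from the same rule by induction on
the left factor (`permElt_mul_assoc`). -/

noncomputable section

open StepFlag

/-! ### Simple transpositions, Demazure steps and rank functions of permutations. -/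

section Permutations

variable {n : ℕ}

/-- The lower of the two indices exchanged by the `i`-th simple transposition. -/
def lowIdx (i : Fin (n - 1)) : Fin n := ⟨i, by omega⟩

/-- The upper of the two indices exchanged by the `i`-th simple transposition. -/
def highIdx (i : Fin (n - 1)) : Fin n := ⟨i + 1, by omega⟩

/-- The `i`-th simple transposition. -/
def adjSwap (i : Fin (n - 1)) : Equiv.Perm (Fin n) := Equiv.swap (lowIdx i) (highIdx i)

@[simp] theorem val_lowIdx (i : Fin (n - 1)) : (lowIdx i : ℕ) = i := rfl

@[simp] theorem val_highIdx (i : Fin (n - 1)) : (highIdx i : ℕ) = i + 1 := rfl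

theorem lowIdx_ne_highIdx (i : Fin (n - 1)) : lowIdx i ≠ highIdx i := by
  simp [Fin.ext_iff]

@[simp] theorem adjSwap_low (i : Fin (n - 1)) : adjSwap i (lowIdx i) = highIdx i :=
  Equiv.swap_apply_left _ _

@[simp] theorem adjSwap_high (i : Fin (n - 1)) : adjSwap i (highIdx i) = lowIdx i :=
  Equiv.swap_apply_right _ _

theorem adjSwap_of_ne {i : Fin (n - 1)} {j : Fin n} (h : j ≠ lowIdx i) (h' : j ≠ highIdx i) :
    adjSwap i j = j :=
  Equiv.swap_apply_of_ne_of_ne h h'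

@[simp] theorem adjSwap_inv (i : Fin (n - 1)) : (adjSwap i)⁻¹ = adjSwap i := Equiv.swap_inv _ _

@[simp] theorem adjSwap_mul_cancel (i : Fin (n - 1)) (σ : Equiv.Perm (Fin n)) :
    adjSwap i * (adjSwap i * σ) = σ := Equiv.swap_mul_self_mul _ _ σ

theorem val_adjSwap (i : Fin (n - 1)) (j : Fin n) :
    (adjSwap i j : ℕ) = if (j : ℕ) = i then (i : ℕ) + 1 else if (j : ℕ) = i + 1 then (i : ℕ)
      else j := by
  simp only [adjSwap, Equiv.swap_apply_def, Fin.ext_iff, val_lowIdx, val_highIdx]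
  split_ifs <;> simp

theorem adjSwap_inv_low (i : Fin (n - 1)) (σ : Equiv.Perm (Fin n)) :
    (adjSwap i * σ)⁻¹ (lowIdx i) = σ⁻¹ (highIdx i) := by
  rw [mul_inv_rev, adjSwap_inv, Equiv.Perm.mul_apply, adjSwap_low]

theorem adjSwap_inv_high (i : Fin (n - 1)) (σ : Equiv.Perm (Fin n)) :
    (adjSwap i * σ)⁻¹ (highIdx i) = σ⁻¹ (lowIdx i) := by
  rw [mul_inv_rev, adjSwap_inv, Equiv.Perm.mul_apply, adjSwap_high]

/-- `s_i σ` is longer than `σ`. -/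
def IsAscent (i : Fin (n - 1)) (σ : Equiv.Perm (Fin n)) : Prop :=
  σ⁻¹ (lowIdx i) < σ⁻¹ (highIdx i)

theorem not_isAscent {i : Fin (n - 1)} {σ : Equiv.Perm (Fin n)} :
    ¬ IsAscent i σ ↔ σ⁻¹ (highIdx i) < σ⁻¹ (lowIdx i) := by
  rw [IsAscent, not_lt]
  exact ⟨fun h => lt_of_le_of_ne h fun h' => lowIdx_ne_highIdx i (σ⁻¹.injective h').symm, le_of_lt⟩

theorem isAscent_adjSwap_mul {i : Fin (n - 1)} {σ : Equiv.Perm (Fin n)} :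
    IsAscent i (adjSwap i * σ) ↔ ¬ IsAscent i σ := by
  rw [not_isAscent, IsAscent, adjSwap_inv_low, adjSwap_inv_high]

theorem isAscent_one (i : Fin (n - 1)) : IsAscent i (1 : Equiv.Perm (Fin n)) := by
  simp [IsAscent, Fin.lt_def]

open Classical in
/-- The Demazure product of the `i`-th simple transposition with `σ`. -/
def demazureStep (i : Fin (n - 1)) (σ : Equiv.Perm (Fin n)) : Equiv.Perm (Fin n) :=
  if IsAscent i σ then adjSwap i * σ else σ

theorem demazureStep_of_isAscent {i : Fin (n - 1)} {σ : Equiv.Perm (Fin n)} (h : IsAscent i σ) :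
    demazureStep i σ = adjSwap i * σ := if_pos h

theorem demazureStep_of_not_isAscent {i : Fin (n - 1)} {σ : Equiv.Perm (Fin n)}
    (h : ¬ IsAscent i σ) : demazureStep i σ = σ := if_neg h

theorem not_isAscent_demazureStep (i : Fin (n - 1)) (σ : Equiv.Perm (Fin n)) :
    ¬ IsAscent i (demazureStep i σ) := by
  by_cases h : IsAscent i σ
  · rwa [demazureStep_of_isAscent h, isAscent_adjSwap_mul, not_not]
  · rwa [demazureStep_of_not_isAscent h]

theorem demazureStep_idem (i : Fin (n - 1)) (σ : Equiv.Perm (Fin n)) :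
    demazureStep i (demazureStep i σ) = demazureStep i σ :=
  demazureStep_of_not_isAscent (not_isAscent_demazureStep i σ)

/-- Without descents σ⁻¹ is increasing, and a finite chain has only the trivial order automorphism.
-/
theorem eq_one_of_forall_isAscent {σ : Equiv.Perm (Fin n)} (h : ∀ i, IsAscent i σ) : σ = 1 := by
  have hm : StrictMono (⇑σ⁻¹ : Fin n → Fin n) := by
    cases n with
    | zero => exact fun a => a.elim0
    | succ m => exact Fin.strictMono_iff_lt_succ.2 fun i => h i
  rw [← inv_eq_one]
  ext i
  have := congrFun (Subsingleton.elim (hm.orderIsoOfSurjective _ σ⁻¹.surjective)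
    (OrderIso.refl (Fin n)) |> congrArg (fun e : Fin n ≃o Fin n => (e : Fin n → Fin n))) i
  exact congrArg Fin.val this

/-- Every permutation is reached from the identity by length-increasing simple transpositions. -/
theorem perm_ascent_induction {P : Equiv.Perm (Fin n) → Prop} (one : P 1)
    (step : ∀ i σ, IsAscent i σ → P σ → P (adjSwap i * σ)) (σ : Equiv.Perm (Fin n)) : P σ := by
  -- Permutations are compared lexicographically through the value lists of their inverses. Removing
  -- a descent at i keeps the entries before `lowIdx i` and lowers the entry there.
  have wf : WellFounded fun σ τ : Equiv.Perm (Fin n) =>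
      toLex (fun j => σ⁻¹ j) < toLex (fun j => τ⁻¹ j) :=
    InvImage.wf (fun σ : Equiv.Perm (Fin n) => toLex fun j => σ⁻¹ j) wellFounded_lt
  induction σ using wf.induction with
  | h σ ih =>
    by_cases h : ∀ i, IsAscent i σ
    · rw [eq_one_of_forall_isAscent h]; exact one
    · push Not at h
      obtain ⟨i, hi⟩ := h
      rw [← adjSwap_mul_cancel i σ]
      refine step i _ (isAscent_adjSwap_mul.2 hi) (ih _ ⟨lowIdx i, fun j hj => ?_, ?_⟩)
      · change (adjSwap i * σ)⁻¹ j = σ⁻¹ j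
        rw [mul_inv_rev, adjSwap_inv, Equiv.Perm.mul_apply, adjSwap_of_ne hj.ne]
        exact (hj.trans (by simp [Fin.lt_def])).ne
      · change (adjSwap i * σ)⁻¹ (lowIdx i) < σ⁻¹ (lowIdx i)
        rw [adjSwap_inv_low]
        exact not_isAscent.1 hi

/-- The number of `l < b` with `σ l < a`. -/
def permRank (σ : Equiv.Perm (Fin n)) (a b : ℕ) : ℕ :=
  (Finset.univ.filter fun l : Fin n => (l : ℕ) < b ∧ (σ l : ℕ) < a).card

theorem permRank_succ_right (σ : Equiv.Perm (Fin n)) (a : ℕ) (l : Fin n) :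
    permRank σ a (l + 1) = permRank σ a l + if (σ l : ℕ) < a then 1 else 0 := by
  unfold permRank
  split_ifs with h
  · rw [← Finset.card_insert_of_notMem (a := l) (by simp)]
    congr 1
    ext j
    simp only [Finset.mem_filter, Finset.mem_univ, true_and, Finset.mem_insert]
    constructor
    · rintro ⟨h1, h2⟩
      rcases Nat.lt_succ_iff_lt_or_eq.1 h1 with h3 | h3
      · exact Or.inr ⟨h3, h2⟩
      · exact Or.inl (Fin.ext h3)
    · rintro (rfl | ⟨h1, h2⟩)
      · exact ⟨Nat.lt_succ_self _, h⟩
      · exact ⟨by omega, h2⟩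
  · rw [add_zero]
    congr 1
    ext j
    simp only [Finset.mem_filter, Finset.mem_univ, true_and]
    constructor
    · rintro ⟨h1, h2⟩
      rcases Nat.lt_succ_iff_lt_or_eq.1 h1 with h3 | h3
      · exact ⟨h3, h2⟩
      · obtain rfl := Fin.ext h3
        exact absurd h2 h
    · rintro ⟨h1, h2⟩
      exact ⟨by omega, h2⟩

theorem permRank_inv (σ : Equiv.Perm (Fin n)) (a b : ℕ) : permRank σ⁻¹ a b = permRank σ b a := by
  unfold permRank
  refine Finset.card_bij (fun l _ => σ⁻¹ l) ?_ ?_ ?_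
  · intro l hl
    simpa [and_comm] using hl
  · intro l _ l' _ h
    exact σ⁻¹.injective h
  · intro l hl
    exact ⟨σ l, by simpa [and_comm] using hl, by simp⟩

theorem permRank_succ_left (σ : Equiv.Perm (Fin n)) (j : Fin n) (b : ℕ) :
    permRank σ (j + 1) b = permRank σ j b + if (σ⁻¹ j : ℕ) < b then 1 else 0 := by
  rw [← permRank_inv, permRank_succ_right, permRank_inv]

/-- The increment of the rank from b = l to b = l + 1 tells whether σ l < a; letting a vary
determines σ l. -/
theorem permRank_injective {σ τ : Equiv.Perm (Fin n)}
    (h : ∀ a b, a ≤ n → b ≤ n → permRank σ a b = permRank τ a b) : σ = τ := by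
  have key : ∀ (l : Fin n) (a : ℕ), a ≤ n → ((σ l : ℕ) < a ↔ (τ l : ℕ) < a) := by
    intro l a ha
    have h1 := permRank_succ_right σ a l
    have h2 := permRank_succ_right τ a l
    rw [h a _ ha (by omega), h a _ ha (by omega)] at h1
    split_ifs at h1 h2 <;> omega
  ext l
  have h1 := (key l (σ l + 1) (by omega)).1 (by omega)
  have h2 := (key l (τ l + 1) (by omega)).2 (by omega)
  omega

theorem permRank_adjSwap_mul {i : Fin (n - 1)} (σ : Equiv.Perm (Fin n)) {a : ℕ}
    (ha : a ≠ i + 1) (b : ℕ) : permRank (adjSwap i * σ) a b = permRank σ a b := by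
  unfold permRank
  congr 1
  refine Finset.filter_congr fun l _ => and_congr_right fun _ => ?_
  rw [Equiv.Perm.mul_apply, val_adjSwap]
  split_ifs <;> omega

theorem permRank_demazureStep_of_ne {i : Fin (n - 1)} (σ : Equiv.Perm (Fin n)) {a : ℕ}
    (ha : a ≠ i + 1) (b : ℕ) : permRank (demazureStep i σ) a b = permRank σ a b := by
  by_cases h : IsAscent i σ
  · rw [demazureStep_of_isAscent h, permRank_adjSwap_mul σ ha]
  · rw [demazureStep_of_not_isAscent h]

/-- After the step, the value i + 1 occurs at an earlier position than the value i. If the first b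
positions contain the value i they therefore contain both, and the middle row is one less than the
upper row; otherwise it equals the lower row. For any complete flag each of these two numbers is a
lower bound for the middle dimension, which is how `permRank_demazureStep_le` uses this. -/
theorem permRank_demazureStep (i : Fin (n - 1)) (σ : Equiv.Perm (Fin n)) (b : ℕ) :
    permRank (demazureStep i σ) (i + 1) b ≤ max (permRank σ i b) (permRank σ (i + 2) b - 1) := by
  have h1 := permRank_succ_left σ (lowIdx i) b
  have h2 := permRank_succ_left σ (highIdx i) b
  have h3 := permRank_succ_left (adjSwap i * σ) (lowIdx i) b
  rw [adjSwap_inv_low] at h3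
  simp only [val_lowIdx, val_highIdx, add_assoc, Nat.reduceAdd] at h1 h2 h3
  rw [permRank_adjSwap_mul σ (a := i) (by omega)] at h3
  by_cases h : IsAscent i σ
  · rw [demazureStep_of_isAscent h]
    have h4 := Fin.lt_def.1 h
    split_ifs at * <;> omega
  · rw [demazureStep_of_not_isAscent h]
    have h4 := Fin.lt_def.1 (not_isAscent.1 h)
    split_ifs at * <;> omega

end Permutations

/-! ### Relative position of complete flags and the Demazure product. -/

section RelativePosition

variable {k V : Type*} [Field k] [AddCommGroup V] [Module k V] {n : ℕ}

theorem lowIdx_succ (i : Fin (n - 1)) : (lowIdx i).succ = (highIdx i).castSucc := rfl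

namespace StepFlag

theorem IsComplete.finrank_space {f : StepFlag k V n} (hf : f.IsComplete) (a : Fin (n + 1)) :
    Module.finrank k (f.space a) = a := by
  induction a using Fin.induction with
  | zero => rw [f.zero', finrank_bot]; rfl
  | succ i ih => rw [hf i, ih]; simp

theorem ofBasis_space_eq_span (v : Module.Basis (Fin n) k V) (σ : Equiv.Perm (Fin n))
    (a : Fin (n + 1)) :
    (ofBasis (v.reindex σ)).space a = Submodule.span k (v '' {l | (σ l : ℕ) < a}) := by
  change Submodule.span k (_ '' _) = _
  congr 1
  ext x
  constructor
  · rintro ⟨j, hj, rfl⟩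
    exact ⟨σ.symm j, by simpa [Fin.lt_def] using hj, by simp⟩
  · rintro ⟨l, hl, rfl⟩
    exact ⟨σ l, by simpa [Fin.lt_def] using hl, by simp⟩

theorem mem_ofBasis_reindex_iff (v : Module.Basis (Fin n) k V) (σ : Equiv.Perm (Fin n))
    (l : Fin n) (a : Fin (n + 1)) :
    v l ∈ (ofBasis (v.reindex σ)).space a ↔ (σ l : ℕ) < a := by
  rw [ofBasis_space_eq_span, Module.Basis.self_mem_span_image]
  rfl

theorem mem_ofBasis_iff (v : Module.Basis (Fin n) k V) (l : Fin n) (a : Fin (n + 1)) :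
    v l ∈ (ofBasis v).space a ↔ (l : ℕ) < a := by
  have := mem_ofBasis_reindex_iff v 1 l a
  rwa [Equiv.Perm.one_def, Module.Basis.reindex_refl] at this

variable [Module.Finite k V]

theorem IsComplete.finrank_inf_succ_le {f : StepFlag k V n} (hf : f.IsComplete) (j : Fin n)
    (W : Submodule k V) :
    Module.finrank k (f.space j.succ ⊓ W : Submodule k V) ≤
      Module.finrank k (f.space j.castSucc ⊓ W : Submodule k V) + 1 := by
  have h1 := Submodule.finrank_sup_add_finrank_inf_eq (f.space j.castSucc) (f.space j.succ ⊓ W)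
  rw [← inf_assoc, inf_eq_left.2 (f.monotone' j.castSucc_lt_succ.le)] at h1
  have h2 : Module.finrank k (f.space j.castSucc ⊔ f.space j.succ ⊓ W : Submodule k V) ≤
      Module.finrank k (f.space j.succ) :=
    Submodule.finrank_mono (sup_le (f.monotone' j.castSucc_lt_succ.le) inf_le_left)
  have h3 := hf j
  omega

theorem IsComplete.exists_sub_smul_mem {f : StepFlag k V n} (hf : f.IsComplete) {j : Fin n}
    {x y : V} (hx : x ∈ f.space j.succ) (hx' : x ∉ f.space j.castSucc)
    (hy : y ∈ f.space j.succ) : ∃ c : k, y - c • x ∈ f.space j.castSucc := by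
  have hlt : f.space j.castSucc < f.space j.castSucc ⊔ Submodule.span k {x} :=
    lt_of_le_of_ne le_sup_left fun h => hx' <| h ▸
      Submodule.mem_sup_right (Submodule.mem_span_singleton_self x)
  have heq : f.space j.castSucc ⊔ Submodule.span k {x} = f.space j.succ := by
    refine Submodule.eq_of_le_of_finrank_le (sup_le (f.monotone' j.castSucc_lt_succ.le) ?_) ?_
    · rwa [Submodule.span_singleton_le_iff_mem]
    · rw [hf j]
      exact Submodule.finrank_lt_finrank_of_lt hlt
  rw [← heq] at hy
  obtain ⟨z, hz, w, hw, rfl⟩ := Submodule.mem_sup.1 hy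
  obtain ⟨c, rfl⟩ := Submodule.mem_span_singleton.1 hw
  exact ⟨c, by simpa using hz⟩

theorem IsComplete.ofBasis_space_eq {f : StepFlag k V n} (hf : f.IsComplete)
    (w : Module.Basis (Fin n) k V) (a : Fin (n + 1))
    (h : ∀ j : Fin n, (j : ℕ) < a → w j ∈ f.space a) : (ofBasis w).space a = f.space a := by
  refine Submodule.eq_of_le_of_finrank_eq (Submodule.span_le.2 ?_) ?_
  · rintro _ ⟨j, hj, rfl⟩
    exact h j (Fin.lt_def.1 hj)
  · rw [hf.finrank_space, (ofBasis_isComplete w).finrank_space]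

theorem IsComplete.ofBasis_eq {f : StepFlag k V n} (hf : f.IsComplete)
    (w : Module.Basis (Fin n) k V) (h : ∀ j : Fin n, w j ∈ f.space j.succ) : ofBasis w = f := by
  ext1
  funext a
  exact hf.ofBasis_space_eq w a fun j hj =>
    f.monotone' (Fin.le_def.2 (by simpa using hj)) (h j)

/-- Vectors adapted to the steps of a complete flag form a basis. -/
theorem IsComplete.exists_basis {f : StepFlag k V n} (hf : f.IsComplete) (w : Fin n → V)
    (h : ∀ j, w j ∈ f.space j.succ) (h' : ∀ j, w j ∉ f.space j.castSucc) :
    ∃ v : Module.Basis (Fin n) k V, ⇑v = w := by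
  have hli : LinearIndependent k w := by
    classical
    rw [Fintype.linearIndependent_iff]
    intro g hg
    by_contra! hne
    -- In a nontrivial relation, solving for the vector with the last nonzero coefficient places it
    -- in the preceding step, contrary to `h'`.
    obtain ⟨j, hj, hmax⟩ := (Finset.univ.filter fun j => g j ≠ 0).exists_maximal
      (by obtain ⟨j, hj⟩ := hne; exact ⟨j, by simpa using hj⟩)
    have hj0 : g j ≠ 0 := (Finset.mem_filter.1 hj).2
    have hsum : g j • w j = - ∑ l ∈ Finset.univ.erase j, g l • w l := by
      rw [eq_neg_iff_add_eq_zero, Finset.add_sum_erase _ (fun l => g l • w l) (Finset.mem_univ j),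
        hg]
    refine h' j ((Submodule.smul_mem_iff _ hj0).1 ?_)
    rw [hsum]
    refine neg_mem (sum_mem fun l hl => ?_)
    by_cases hl0 : g l = 0
    · rw [hl0, zero_smul]; exact zero_mem _
    · have hlj : l < j := by
        have h1 := Finset.ne_of_mem_erase hl
        by_contra hlt
        have := hmax (y := l) (by simpa using hl0) (le_of_not_gt hlt)
        exact h1 (le_antisymm this (le_of_not_gt hlt))
      exact Submodule.smul_mem _ _ (f.monotone' (Fin.succ_le_castSucc_iff.2 hlj) (h l))
  have hcard : Fintype.card (Fin n) = Module.finrank k V := by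
    rw [← finrank_top k V, ← f.last', hf.finrank_space]; simp
  exact ⟨_, coe_basisOfLinearIndependentOfCardEqFinrank' w hli hcard⟩

end StepFlag

/-- The complete flags `p` and `q` are in relative position `σ`. -/
def RelPos (σ : Equiv.Perm (Fin n)) (p q : StepFlag k V n) : Prop :=
  ∃ v : Module.Basis (Fin n) k V, ofBasis (v.reindex σ) = p ∧ ofBasis v = q

namespace RelPos

variable {σ τ m : Equiv.Perm (Fin n)} {p p' q : StepFlag k V n}

theorem isComplete_left (h : RelPos σ p q) : p.IsComplete := by
  obtain ⟨v, rfl, -⟩ := h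
  exact ofBasis_isComplete _

theorem isComplete_right (h : RelPos σ p q) : q.IsComplete := by
  obtain ⟨v, -, rfl⟩ := h
  exact ofBasis_isComplete _

theorem one_iff [Module.Finite k V] : RelPos 1 p q ↔ p = q ∧ q.IsComplete := by
  constructor
  · rintro ⟨v, rfl, rfl⟩
    rw [Equiv.Perm.one_def, Module.Basis.reindex_refl]
    exact ⟨rfl, ofBasis_isComplete _⟩
  · rintro ⟨rfl, hp⟩
    have : ∀ j : Fin n, ∃ x ∈ p.space j.succ, x ∉ p.space j.castSucc := fun j =>
      SetLike.exists_of_lt <| lt_of_le_of_ne (p.monotone' j.castSucc_lt_succ.le) fun h => by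
        have := hp j
        rw [h] at this
        omega
    choose w h h' using this
    obtain ⟨v, rfl⟩ := hp.exists_basis w h h'
    exact ⟨v, by rw [Equiv.Perm.one_def, Module.Basis.reindex_refl]; exact hp.ofBasis_eq v h,
      hp.ofBasis_eq v h⟩

theorem of_mem [Module.Finite k V] (hp : p.IsComplete) (hq : q.IsComplete)
    (w : Fin n → V) (h : ∀ j, w j ∈ q.space j.succ) (h' : ∀ j, w j ∉ q.space j.castSucc)
    (hσ : ∀ j, w j ∈ p.space (σ j).succ) : RelPos σ p q := by
  obtain ⟨v, rfl⟩ := hq.exists_basis w h h'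
  refine ⟨v, hp.ofBasis_eq _ fun j => ?_, hq.ofBasis_eq v h⟩
  simpa using hσ (σ.symm j)

/-- One basis is adapted to both flags, so the intersection is the span of the basis vectors common
to the two coordinate subspaces. -/
theorem finrank_inf (h : RelPos σ p q) (a b : Fin (n + 1)) :
    Module.finrank k (p.space a ⊓ q.space b : Submodule k V) = permRank σ a b := by
  obtain ⟨v, rfl, rfl⟩ := h
  have h1 : (ofBasis (v.reindex σ)).space a ⊓ (ofBasis v).space b =
      Submodule.span k (v '' {l | (l : ℕ) < b ∧ (σ l : ℕ) < a}) := by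
    rw [ofBasis_space_eq_span]
    ext x
    rw [Submodule.mem_inf, Module.Basis.mem_span_image]
    change _ ∧ x ∈ Submodule.span k _ ↔ _
    rw [Module.Basis.mem_span_image, Module.Basis.mem_span_image, ← Set.subset_inter_iff]
    have : {l : Fin n | (σ l : ℕ) < a} ∩ {i | i.castSucc < b} =
        {l : Fin n | (l : ℕ) < b ∧ (σ l : ℕ) < a} := by
      ext l
      simp [Fin.lt_def, and_comm]
    rw [this]
  rw [h1, Set.image_eq_range]
  refine (finrank_span_eq_card (v.linearIndependent.comp
    (fun x : {l : Fin n | (l : ℕ) < b ∧ (σ l : ℕ) < a} => (x : Fin n))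
    Subtype.val_injective)).trans ?_
  rw [permRank, ← Fintype.card_subtype]
  rfl

theorem unique (h : RelPos σ p q) (h' : RelPos τ p q) : σ = τ :=
  permRank_injective fun a b ha hb => by
    have h1 := h.finrank_inf ⟨a, by omega⟩ ⟨b, by omega⟩
    rw [h'.finrank_inf] at h1
    exact h1.symm

/-- Bruhat decomposition: any two complete flags have a relative position. -/
theorem exists_of_isComplete [Module.Finite k V] (hp : p.IsComplete) (hq : q.IsComplete) :
    ∃ σ, RelPos σ p q := by
  -- The candidate value σ l is the first step of p reached by a vector that is new at step l of q.
  have hex : ∀ l : Fin n, ∃ a : Fin n, (∃ x ∈ q.space l.succ, x ∉ q.space l.castSucc ∧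
      x ∈ p.space a.succ) ∧
      ∀ x ∈ q.space l.succ, x ∉ q.space l.castSucc → x ∉ p.space a.castSucc := by
    intro l
    by_contra! hcon
    have hno : ∀ a : Fin (n + 1), ∀ x ∈ q.space l.succ, x ∉ q.space l.castSucc →
        x ∉ p.space a := by
      intro a
      induction a using Fin.induction with
      | zero =>
        intro x _ hx' hx
        rw [p.zero', Submodule.mem_bot] at hx
        exact hx' (hx ▸ zero_mem _)
      | succ a ih =>
        intro x hx hx' hxa
        obtain ⟨y, hy, hy', hya⟩ := hcon a ⟨x, hx, hx', hxa⟩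
        exact ih y hy hy' hya
    obtain ⟨x, hx, hx'⟩ : ∃ x ∈ q.space l.succ, x ∉ q.space l.castSucc :=
      SetLike.exists_of_lt <| lt_of_le_of_ne (q.monotone' l.castSucc_lt_succ.le) fun h => by
        have := hq l
        rw [h] at this
        omega
    exact hno (Fin.last n) x hx hx' (by rw [p.last']; trivial)
  choose s hs hmin using hex
  choose w hw hw' hwp using hs
  -- If both were first reached at the same step of p, subtracting a multiple of `w l` from `w l'`
  -- would give a vector still new at step l' of q but lying in an earlier step of p.
  have hlt : ∀ l l', l < l' → s l ≠ s l' := by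
    intro l l' hll he
    obtain ⟨c, hc⟩ := hp.exists_sub_smul_mem (hwp l) (hmin l _ (hw l) (hw' l))
      (he ▸ hwp l' : w l' ∈ p.space (s l).succ)
    have hl : c • w l ∈ q.space l'.castSucc :=
      Submodule.smul_mem _ _ (q.monotone' (Fin.succ_le_castSucc_iff.2 hll) (hw l))
    refine hmin l' (w l' - c • w l) (sub_mem (hw l')
      (q.monotone' l'.castSucc_lt_succ.le hl)) (fun h => hw' l' ?_) (he ▸ hc)
    simpa using add_mem h hl
  have hinj : Function.Injective s := by
    intro l l' h
    rcases lt_trichotomy l l' with h1 | h1 | h1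
    · exact absurd h (hlt _ _ h1)
    · exact h1
    · exact absurd h.symm (hlt _ _ h1)
  exact ⟨Equiv.ofBijective s (Finite.injective_iff_bijective.1 hinj),
    of_mem hp hq w hw hw' hwp⟩

end RelPos

/-- Two flags that agree except possibly at the step moved by the `i`-th simple transposition. -/
def AgreeOff (i : Fin (n - 1)) (p p' : StepFlag k V n) : Prop :=
  ∀ a, a ≠ (lowIdx i).succ → p.space a = p'.space a

variable {i : Fin (n - 1)} {σ τ m : Equiv.Perm (Fin n)} {p p' q : StepFlag k V n}

/-- Only step i + 1 of the flag may change. There the dimension of the intersection is at least that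
at step i, and at least that at step i + 2 minus one; both neighbouring steps are shared with p, so
`permRank_demazureStep` applies. -/
theorem permRank_demazureStep_le [Module.Finite k V] (hp' : p'.IsComplete) (h : AgreeOff i p p')
    (hm : ∀ a b, permRank m (a : Fin (n + 1)) (b : Fin (n + 1)) ≤
      Module.finrank k (p.space a ⊓ q.space b : Submodule k V)) (a b : Fin (n + 1)) :
    permRank (demazureStep i m) a b ≤
      Module.finrank k (p'.space a ⊓ q.space b : Submodule k V) := by
  by_cases ha : a = (lowIdx i).succ
  · subst ha
    have h0 := permRank_demazureStep i m b
    have h1 := hm (lowIdx i).castSucc b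
    have h2 := hm (highIdx i).succ b
    rw [h _ (by simp [Fin.ext_iff])] at h1 h2
    have h3 := hp'.finrank_inf_succ_le (highIdx i) (q.space b)
    have h4 : Module.finrank k (p'.space (lowIdx i).castSucc ⊓ q.space b : Submodule k V) ≤
        Module.finrank k (p'.space (lowIdx i).succ ⊓ q.space b : Submodule k V) :=
      Submodule.finrank_mono (inf_le_inf_right _ (p'.monotone' (lowIdx i).castSucc_lt_succ.le))
    rw [← lowIdx_succ] at h3
    simp only [Fin.val_succ, Fin.val_castSucc, val_lowIdx, val_highIdx, add_assoc,
      Nat.reduceAdd] at h0 h1 h2 h3 h4 ⊢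
    omega
  · rw [← h a ha, permRank_demazureStep_of_ne m (fun hh => ha (Fin.ext hh))]
    exact hm a b

theorem agreeOff_adjSwap (v : Module.Basis (Fin n) k V) :
    AgreeOff i (ofBasis (v.reindex σ)) (ofBasis (v.reindex (adjSwap i * σ))) := by
  intro a ha
  rw [ofBasis_space_eq_span, ofBasis_space_eq_span]
  have ha' : (a : ℕ) ≠ i + 1 := fun h => ha (Fin.ext h)
  congr 2
  ext l
  simp only [Set.mem_ofPred_eq, Equiv.Perm.mul_apply, val_adjSwap]
  split_ifs <;> omega

/-- Some flag differing from `p` exactly at one step is in the Demazure position. -/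
theorem RelPos.exists_neighbour [Module.Finite k V] (h : RelPos m p q) (i : Fin (n - 1)) :
    ∃ p', AgreeOff i p p' ∧ p.space (lowIdx i).succ ≠ p'.space (lowIdx i).succ ∧
      RelPos (demazureStep i m) p' q := by
  obtain ⟨v, rfl, rfl⟩ := h
  by_cases hi : IsAscent i m
  · refine ⟨ofBasis (v.reindex (adjSwap i * m)), agreeOff_adjSwap v, fun hne => ?_,
      v, by rw [demazureStep_of_isAscent hi], rfl⟩
    have h1 := mem_ofBasis_reindex_iff v m (m⁻¹ (lowIdx i)) (lowIdx i).succ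
    rw [hne, mem_ofBasis_reindex_iff] at h1
    simp at h1
  -- At a descent d < c, so replacing v c by v c + v d preserves the flag q, while the line added to
  -- p at step i + 1 becomes a different one. The position remains m.
  · have hlt := not_isAscent.1 hi
    set c := m⁻¹ (lowIdx i) with hc
    set d := m⁻¹ (highIdx i) with hd
    have hmc : m c = lowIdx i := by simp [hc]
    have hmd : m d = highIdx i := by simp [hd]
    have hvd : v d ∈ (ofBasis v).space c.castSucc := (mem_ofBasis_iff v d _).2 hlt
    have hmem : ∀ j, Function.update v c (v c + v d) j ∈ (ofBasis v).space j.succ := by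
      intro j
      by_cases hj : j = c
      · subst hj
        rw [Function.update_self]
        exact add_mem ((mem_ofBasis_iff v _ _).2 (by simp))
          ((ofBasis v).monotone' (Fin.castSucc_lt_succ).le hvd)
      · rw [Function.update_of_ne hj]
        exact (mem_ofBasis_iff v _ _).2 (by simp)
    obtain ⟨w, hw⟩ := (ofBasis_isComplete v).exists_basis (Function.update v c (v c + v d)) hmem
      (fun j hj => by
        by_cases hjc : j = c
        · subst hjc
          rw [Function.update_self, Submodule.add_mem_iff_left _ hvd, mem_ofBasis_iff] at hj
          simp at hj
        · rw [Function.update_of_ne hjc, mem_ofBasis_iff] at hj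
          simp at hj)
    refine ⟨ofBasis (w.reindex m), fun a ha => ?_, fun hne => ?_, w, by
      rw [demazureStep_of_not_isAscent hi], (ofBasis_isComplete v).ofBasis_eq w (hw ▸ hmem)⟩
    · refine ((ofBasis_isComplete _).ofBasis_space_eq _ a fun j hj => ?_).symm
      rw [Module.Basis.reindex_apply, hw]
      by_cases hj' : m.symm j = c
      · have hj0 : j = lowIdx i := by rw [← hmc, ← hj']; simp
        have : (a : ℕ) ≠ i + 1 := fun h => ha (Fin.ext h)
        subst hj0
        simp only [val_lowIdx] at hj
        rw [hj', Function.update_self]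
        refine add_mem ((mem_ofBasis_reindex_iff v _ _ _).2 ?_)
          ((mem_ofBasis_reindex_iff v _ _ _).2 ?_)
        · rw [hmc]; exact hj
        · rw [hmd, val_highIdx]; omega
      · rw [Function.update_of_ne hj', mem_ofBasis_reindex_iff]
        simpa using hj
    · have h1 : w c ∈ (ofBasis (w.reindex m)).space (lowIdx i).succ :=
        (mem_ofBasis_reindex_iff w m c _).2 (by rw [hmc]; simp)
      rw [← hne, hw, Function.update_self, Submodule.add_mem_iff_right _
        ((mem_ofBasis_reindex_iff v m c _).2 (by rw [hmc]; simp)), mem_ofBasis_reindex_iff,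
        hmd] at h1
      simp at h1

/-- At an ascent, any two flags differing exactly at one step have the same position. -/
theorem RelPos.adjSwap_of_agreeOff [Module.Finite k V] (h : RelPos σ p q) (hi : IsAscent i σ)
    (hp' : p'.IsComplete) (ha : AgreeOff i p p')
    (hne : p.space (lowIdx i).succ ≠ p'.space (lowIdx i).succ) :
    RelPos (adjSwap i * σ) p' q := by
  have hp := h.isComplete_left
  have hq := h.isComplete_right
  obtain ⟨v, hvp, hvq⟩ := h
  set c := σ⁻¹ (lowIdx i) with hc
  set d := σ⁻¹ (highIdx i) with hd
  have hsc : σ c = lowIdx i := by simp [hc]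
  have hsd : σ d = highIdx i := by simp [hd]
  have hcd : c < d := hi
  have hlow : p.space (lowIdx i).castSucc = p'.space (lowIdx i).castSucc :=
    ha _ (by simp [Fin.ext_iff])
  have hhigh : p.space (highIdx i).succ = p'.space (highIdx i).succ :=
    ha _ (by simp [Fin.ext_iff])
  have hmem : ∀ l a, v l ∈ p.space a ↔ (σ l : ℕ) < a := by
    intro l a; rw [← hvp, mem_ofBasis_reindex_iff]
  have hmemq : ∀ l a, v l ∈ q.space a ↔ (l : ℕ) < a := by
    intro l a; rw [← hvq, mem_ofBasis_iff]
  obtain ⟨x, hx, hx'⟩ : ∃ x ∈ p'.space (lowIdx i).succ, x ∉ p.space (lowIdx i).succ := by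
    refine SetLike.not_le_iff_exists.1 fun hle => hne (Submodule.eq_of_le_of_finrank_eq hle ?_).symm
    rw [hp.finrank_space, hp'.finrank_space]
  -- Modulo step i of p, the new vector x is α v_d + β v_c, and α ≠ 0 because x lies outside step i
  -- + 1 of p. As c < d, this combination can replace v d in a basis adapted to q, and it now enters
  -- p' before v c does.
  obtain ⟨α, hα⟩ := hp.exists_sub_smul_mem (j := highIdx i) (x := v d) (y := x)
    ((hmem _ _).2 (by rw [hsd]; simp)) (fun h => by rw [hmem, hsd] at h; simp at h)
    (by rw [hhigh]; exact p'.monotone' (lowIdx_succ i ▸ Fin.castSucc_lt_succ.le) hx)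
  obtain ⟨β, hβ⟩ := hp.exists_sub_smul_mem (j := lowIdx i) (x := v c)
    ((hmem _ _).2 (by rw [hsc]; simp)) (fun h => by rw [hmem, hsc] at h; simp at h) hα
  have hα0 : α ≠ 0 := by
    rintro rfl
    rw [zero_smul, sub_zero] at hα
    exact hx' hα
  have hy : α • v d + β • v c ∈ p'.space (lowIdx i).succ := by
    have h1 := p'.monotone' (lowIdx i).castSucc_lt_succ.le (hlow ▸ hβ)
    have h2 := sub_mem hx h1
    have h3 : x - (x - α • v d - β • v c) = α • v d + β • v c := by abel
    rwa [h3] at h2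
  have hβc : β • v c ∈ q.space d.castSucc :=
    Submodule.smul_mem _ _ ((hmemq _ _).2 (by simpa using hcd))
  refine of_mem hp' hq (Function.update v d (α • v d + β • v c)) (fun j => ?_) (fun j hj => ?_)
    fun j => ?_
  · by_cases hj : j = d
    · subst hj
      rw [Function.update_self]
      exact add_mem (Submodule.smul_mem _ _ ((hmemq _ _).2 (by simp)))
        (q.monotone' Fin.castSucc_lt_succ.le hβc)
    · rw [Function.update_of_ne hj, hmemq]
      simp
  · by_cases hjd : j = d
    · subst hjd
      rw [Function.update_self, Submodule.add_mem_iff_left _ hβc, Submodule.smul_mem_iff _ hα0,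
        hmemq] at hj
      simp at hj
    · rw [Function.update_of_ne hjd, hmemq] at hj
      simp at hj
  · by_cases hjd : j = d
    · rw [hjd, Function.update_self, Equiv.Perm.mul_apply, hsd, adjSwap_high]
      exact hy
    · rw [Function.update_of_ne hjd, Equiv.Perm.mul_apply]
      by_cases hjc : j = c
      · rw [hjc, hsc, adjSwap_low, ← hhigh, hmem, hsc]
        simp
      · have h1 : σ j ≠ lowIdx i := fun h => hjc (σ.injective (h.trans hsc.symm))
        have h2 : σ j ≠ highIdx i := fun h => hjd (σ.injective (h.trans hsd.symm))
        rw [adjSwap_of_ne h1 h2, ← ha _ (fun h => h1 (Fin.succ_injective _ h)), hmem]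
        simp

variable (k V) in
/-- `m` is the largest relative position of a pair in `S(σ, τ)`. -/
def IsDemazureProduct (σ τ m : Equiv.Perm (Fin n)) : Prop :=
  (∃ p₁ p₂ p₃ : StepFlag k V n, RelPos σ p₁ p₂ ∧ RelPos τ p₂ p₃ ∧ RelPos m p₁ p₃) ∧
  ∀ p₁ p₂ p₃ : StepFlag k V n, RelPos σ p₁ p₂ → RelPos τ p₂ p₃ → ∀ a b : Fin (n + 1),
    permRank m a b ≤ Module.finrank k (p₁.space a ⊓ p₃.space b : Submodule k V)

namespace IsDemazureProduct

theorem one_left [Module.Finite k V] (b : Module.Basis (Fin n) k V) :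
    IsDemazureProduct k V 1 τ τ := by
  refine ⟨⟨_, ofBasis (b.reindex τ), _, RelPos.one_iff.2 ⟨rfl, ofBasis_isComplete _⟩,
    ⟨b, rfl, rfl⟩, ⟨b, rfl, rfl⟩⟩, fun p₁ p₂ p₃ h₁ h₂ a b => ?_⟩
  obtain ⟨rfl, -⟩ := RelPos.one_iff.1 h₁
  exact (h₂.finrank_inf a b).ge

/-- To attain the new position, move the first flag of an extremal triple to a neighbour in Demazure
position to the third; because i is an ascent of σ, that neighbour is automatically in position s_i
σ to the second. For the bound, any flag in position s_i σ has a neighbour in position σ, to which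
the old bound applies. -/
theorem adjSwap_mul [Module.Finite k V] (h : IsDemazureProduct k V σ τ m) (hi : IsAscent i σ) :
    IsDemazureProduct k V (adjSwap i * σ) τ (demazureStep i m) := by
  refine ⟨?_, fun p₁ p₂ p₃ h₁ h₂ => ?_⟩
  · obtain ⟨p, p₂, p₃, h₁, h₂, h₃⟩ := h.1
    obtain ⟨p', ha, hne, h₄⟩ := h₃.exists_neighbour i
    exact ⟨p', p₂, p₃, h₁.adjSwap_of_agreeOff hi h₄.isComplete_left ha hne, h₂, h₄⟩
  · have hc := h₁.isComplete_left
    obtain ⟨v, rfl, rfl⟩ := h₁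
    exact permRank_demazureStep_le hc (agreeOff_adjSwap v) (h.2 _ _ p₃ ⟨v, rfl, rfl⟩ h₂)

/-- Each position is attained, so each obeys the rank bound of the other. -/
theorem unique {m' : Equiv.Perm (Fin n)} (h : IsDemazureProduct k V σ τ m)
    (h' : IsDemazureProduct k V σ τ m') : m = m' := by
  refine permRank_injective fun a b ha hb => le_antisymm ?_ ?_
  · obtain ⟨p₁, p₂, p₃, h₁, h₂, h₃⟩ := h'.1
    have := h.2 _ _ _ h₁ h₂ ⟨a, by omega⟩ ⟨b, by omega⟩
    rwa [h₃.finrank_inf] at this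
  · obtain ⟨p₁, p₂, p₃, h₁, h₂, h₃⟩ := h.1
    have := h'.2 _ _ _ h₁ h₂ ⟨a, by omega⟩ ⟨b, by omega⟩
    rwa [h₃.finrank_inf] at this

theorem exists_demazure [Module.Finite k V] (b : Module.Basis (Fin n) k V)
    (σ τ : Equiv.Perm (Fin n)) : ∃ m, IsDemazureProduct k V σ τ m := by
  induction σ using perm_ascent_induction with
  | one => exact ⟨τ, one_left b⟩
  | step i σ hi ih =>
    obtain ⟨m, hm⟩ := ih
    exact ⟨_, hm.adjSwap_mul hi⟩

end IsDemazureProduct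

end RelativePosition

/-! ### Semicontinuity of dimensions and restriction of polynomials to lines. -/

section ZariskiTopology

/-- The generating sets are a base and not merely a subbase: the intersection of two principal open
sets is given by the product polynomial. -/
theorem exists_principal_subset {k W : Type*} [Field k] [AddCommGroup W] [Module k W] {O : Set W}
    (hO : IsOpen[zariskiTopology k W] O) {x : W} (hx : x ∈ O) :
    ∃ p : MvPolynomial (Module.Dual k W) k,
      MvPolynomial.eval (fun l : Module.Dual k W => l x) p ≠ 0 ∧
      ∀ y, MvPolynomial.eval (fun l : Module.Dual k W => l y) p ≠ 0 → y ∈ O := by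
  induction hO with
  | basic s hs =>
    obtain ⟨p, rfl⟩ := hs
    exact ⟨p, hx, fun y hy => hy⟩
  | univ => exact ⟨1, by simp, fun _ _ => trivial⟩
  | inter s t _ _ ihs iht =>
    obtain ⟨p, hp, hp'⟩ := ihs hx.1
    obtain ⟨q, hq, hq'⟩ := iht hx.2
    refine ⟨p * q, by rw [map_mul]; exact mul_ne_zero hp hq, fun y hy => ?_⟩
    rw [map_mul] at hy
    exact ⟨hp' y (left_ne_zero_of_mul hy), hq' y (right_ne_zero_of_mul hy)⟩
  | sUnion S _ ih =>
    obtain ⟨s, hs, hxs⟩ := hx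
    obtain ⟨p, hp, hp'⟩ := ih s hs hxs
    exact ⟨p, hp, fun y hy => ⟨s, hs, hp' y hy⟩⟩

/-- A polynomial function restricted to a line is a polynomial in the parameter. -/
theorem exists_eval_line {k W : Type*} [Field k] [AddCommGroup W] [Module k W]
    (p : MvPolynomial (Module.Dual k W) k) (x y : W) :
    ∃ q : Polynomial k, ∀ t : k,
      q.eval t = MvPolynomial.eval (fun l : Module.Dual k W => l (x + t • (y - x))) p := by
  induction p using MvPolynomial.induction_on with
  | C a => exact ⟨Polynomial.C a, fun t => by simp⟩
  | add p q hp hq =>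
    obtain ⟨p', hp'⟩ := hp
    obtain ⟨q', hq'⟩ := hq
    exact ⟨p' + q', fun t => by rw [Polynomial.eval_add, hp', hq', map_add]⟩
  | mul_X p l hp =>
    obtain ⟨p', hp'⟩ := hp
    exact ⟨p' * (Polynomial.C (l x) + Polynomial.X * Polynomial.C (l (y - x))), fun t => by
      rw [Polynomial.eval_mul, hp', map_mul]
      simp⟩

theorem exists_eval_det_line {k V ι : Type*} [Field k] [AddCommGroup V] [Module k V] [Fintype ι]
    [DecidableEq ι] (b : Module.Basis ι k V) (x y : Module.End k V) :
    ∃ q : Polynomial k, ∀ t : k, q.eval t = LinearMap.det (x + t • (y - x)) := by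
  refine ⟨(Matrix.of fun i j => Polynomial.C (LinearMap.toMatrix b b x i j) +
    Polynomial.X * Polynomial.C (LinearMap.toMatrix b b (y - x) i j)).det, fun t => ?_⟩
  rw [← LinearMap.det_toMatrix b, ← Polynomial.coe_evalRingHom, RingHom.map_det]
  congr 1
  ext i j
  rw [map_add, map_smul]
  simp

variable {k V : Type*} [Field k] [AddCommGroup V] [Module k V] {n : ℕ}

/-- The linear form `(g, h) ↦ φ (g x + h y)` on `End(V) × End(V)`. -/
def sumDual (φ : Module.Dual k V) (x y : V) : Module.Dual k (Module.End k V × Module.End k V) :=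
  φ ∘ₗ (LinearMap.applyₗ x ∘ₗ LinearMap.fst k _ _ + LinearMap.applyₗ y ∘ₗ LinearMap.snd k _ _)

theorem sumDual_apply (φ : Module.Dual k V) (x y : V) (g : Module.End k V × Module.End k V) :
    sumDual φ x y g = φ (g.1 x + g.2 y) := rfl

/-- The dimension of `g P + h Q` is a lower semicontinuous function of `(g, h)`. -/
theorem isOpen_le_finrank_sup [Module.Finite k V] (P Q : Submodule k V) (N : ℕ) :
    IsOpen[zariskiTopology k (Module.End k V × Module.End k V)]
      {g | N ≤ Module.finrank k (P.map g.1 ⊔ Q.map g.2 : Submodule k V)} := by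
  let _ := zariskiTopology k (Module.End k V × Module.End k V)
  refine isOpen_iff_forall_mem_open.2 fun g hg => ?_
  let B := Module.finBasis k (P.map g.1 ⊔ Q.map g.2 : Submodule k V)
  have hex : ∀ j : Fin N, ∃ x ∈ P, ∃ y ∈ Q, g.1 x + g.2 y = (B (Fin.castLE hg j) : V) := by
    intro j
    obtain ⟨_, ⟨x, hx, rfl⟩, _, ⟨y, hy, rfl⟩, h⟩ := Submodule.mem_sup.1 (B (Fin.castLE hg j)).2
    exact ⟨x, hx, y, hy, h⟩
  choose x hx y hy hxy using hex
  have hli : LinearIndependent k fun j => g.1 (x j) + g.2 (y j) := by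
    simp only [hxy]
    exact (B.linearIndependent.comp _ (Fin.castLE_injective hg)).map'
      (Submodule.subtype _) (Submodule.ker_subtype _)
  -- G gives coordinates dual to the chosen independent vectors g x_j + h y_j. The determinant F of
  -- these coordinates is 1 at the given point, and wherever it is nonzero the corresponding vectors
  -- remain independent.
  obtain ⟨G, hG⟩ := LinearMap.exists_leftInverse_of_injective
    (Fintype.linearCombination k fun j => g.1 (x j) + g.2 (y j))
    (LinearMap.ker_eq_bot.2 hli.fintypeLinearCombination_injective)
  have hdual : ∀ j, G (g.1 (x j) + g.2 (y j)) = Pi.single j 1 := by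
    intro j
    have := LinearMap.congr_fun hG (Pi.single j 1)
    rwa [LinearMap.comp_apply, Fintype.linearCombination_apply_single, one_smul] at this
  let F : MvPolynomial (Module.Dual k (Module.End k V × Module.End k V)) k :=
    (Matrix.of fun i j : Fin N =>
      MvPolynomial.X (sumDual (LinearMap.proj i ∘ₗ G) (x j) (y j))).det
  have hF : ∀ h : Module.End k V × Module.End k V,
      MvPolynomial.eval (fun l : Module.Dual k _ => l h) F =
        (Matrix.of fun i j : Fin N => G (h.1 (x j) + h.2 (y j)) i).det := by
    intro h
    rw [RingHom.map_det]
    congr 1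
    ext i j
    simp [sumDual_apply]
  refine ⟨{h | MvPolynomial.eval (fun l : Module.Dual k _ => l h) F ≠ 0}, fun h hh => ?_,
    TopologicalSpace.GenerateOpen.basic _ ⟨F, rfl⟩, ?_⟩
  · have hli' : LinearIndependent k fun j => h.1 (x j) + h.2 (y j) := by
      rw [Fintype.linearIndependent_iff]
      intro c hc
      refine congrFun (Matrix.eq_zero_of_mulVec_eq_zero (by rw [← hF]; exact hh) (v := c) ?_)
      ext i
      have := congrFun (congrArg G hc) i
      rw [map_sum, Finset.sum_apply, map_zero] at this
      simpa [Matrix.mulVec, dotProduct, mul_comm, mul_add] using this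
    rw [Set.mem_ofPred_eq]
    calc N = Module.finrank k (Submodule.span k (Set.range fun j => h.1 (x j) + h.2 (y j))) := by
          rw [finrank_span_eq_card hli', Fintype.card_fin]
      _ ≤ _ := by
          refine Submodule.finrank_mono (Submodule.span_le.2 ?_)
          rintro _ ⟨j, rfl⟩
          exact add_mem (Submodule.mem_sup_left ⟨_, hx j, rfl⟩)
            (Submodule.mem_sup_right ⟨_, hy j, rfl⟩)
  · rw [Set.mem_ofPred_eq, hF]
    have : (Matrix.of fun i j : Fin N => G (g.1 (x j) + g.2 (y j)) i) = 1 := by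
      ext i j
      rw [Matrix.of_apply, hdual, Matrix.one_apply, Pi.single_apply]
    rw [this, Matrix.det_one]
    exact one_ne_zero

theorem finrank_map_generalLinear (g : LinearMap.GeneralLinearGroup k V) (P : Submodule k V) :
    Module.finrank k (P.map (g : V →ₗ[k] V)) = Module.finrank k P :=
  LinearEquiv.finrank_map_eq (LinearMap.GeneralLinearGroup.generalLinearEquiv k V g) P

/-- The dimension of the intersection of steps is upper semicontinuous on pairs of flags. -/
theorem isOpen_finrank_inf_le [Module.Finite k V] (a b : Fin (n + 1)) (N : ℕ) :
    IsOpen[zariskiFlagPairs k V n]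
      {p | Module.finrank k (p.1.space a ⊓ p.2.space b : Submodule k V) ≤ N} := by
  rw [isOpen_iSup_iff]
  intro p
  rw [isOpen_coinduced]
  -- Since g and h preserve dimensions, an upper bound N on the intersection is a lower bound on the
  -- sum. If N exceeds the total dimension, the truncated difference is 0 and both conditions hold
  -- everywhere.
  refine ⟨_, isOpen_le_finrank_sup (p.1.space a) (p.2.space b)
    (Module.finrank k (p.1.space a) + Module.finrank k (p.2.space b) - N), ?_⟩
  ext g
  have h := Submodule.finrank_sup_add_finrank_inf_eq
    ((p.1.space a).map (g.1 : V →ₗ[k] V)) ((p.2.space b).map (g.2 : V →ₗ[k] V))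
  rw [finrank_map_generalLinear, finrank_map_generalLinear] at h
  simp only [Set.mem_preimage, Set.mem_ofPred_eq, smul_space]
  omega

/-- This turns openness among pairs of flags into a nonvanishing condition on pairs of group
elements, which can then be tested along lines. -/
theorem exists_polynomial_of_isOpen {U : Set (StepFlag k V n × StepFlag k V n)}
    (hU : IsOpen[zariskiFlagPairs k V n] U) (p q : StepFlag k V n)
    {g h : LinearMap.GeneralLinearGroup k V} (hgh : (g • p, h • q) ∈ U) :
    ∃ P : MvPolynomial (Module.Dual k (Module.End k V × Module.End k V)) k,
      MvPolynomial.eval (fun l => l ((g : Module.End k V), (h : Module.End k V))) P ≠ 0 ∧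
      ∀ g' h' : LinearMap.GeneralLinearGroup k V,
        MvPolynomial.eval (fun l => l ((g' : Module.End k V), (h' : Module.End k V))) P ≠ 0 →
          (g' • p, h' • q) ∈ U := by
  rw [isOpen_iSup_iff] at hU
  obtain ⟨O, hO, hOU⟩ := isOpen_coinduced.1 (hU (p, q))
  have hmem : ∀ g h : LinearMap.GeneralLinearGroup k V,
      ((g : Module.End k V), (h : Module.End k V)) ∈ O ↔ (g • p, h • q) ∈ U := fun g h =>
    Set.ext_iff.1 hOU (g, h)
  obtain ⟨P, hP, hP'⟩ := exists_principal_subset hO ((hmem g h).2 hgh)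
  exact ⟨P, hP, fun g' h' hh => (hmem g' h').1 (hP' _ hh)⟩

end ZariskiTopology

/-! ### Existence and uniqueness of the open orbit. -/

section OpenOrbit

variable {k V : Type*} [Field k] [AddCommGroup V] [Module k V] {n : ℕ}

theorem smul_mem_orbit_iff (c : FlagPairOrbit k V n) (g : LinearMap.GeneralLinearGroup k V)
    (p q : StepFlag k V n) : (g • p, g • q) ∈ c.orbit ↔ (p, q) ∈ c.orbit := by
  rw [MulAction.orbitRel.Quotient.mem_orbit, MulAction.orbitRel.Quotient.mem_orbit]
  have : (Quotient.mk'' (g • p, g • q) : FlagPairOrbit k V n) = Quotient.mk'' (p, q) :=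
    Quotient.sound ⟨g, rfl⟩
  rw [this]

theorem StepFlag.smul_ofBasis (g : LinearMap.GeneralLinearGroup k V)
    (v : Module.Basis (Fin n) k V) :
    g • ofBasis v =
      ofBasis (v.map (LinearMap.GeneralLinearGroup.generalLinearEquiv k V g)) := by
  ext1
  funext i
  change (v.flag i).map (g : V →ₗ[k] V) = Module.Basis.flag _ i
  rw [Module.Basis.flag, Module.Basis.flag, Submodule.map_span, ← Set.image_comp]
  rfl

/-- GL(V) is transitive on bases, so the adapted basis in a relative position may be carried to b.
-/
theorem mem_permOrbit_iff (b : Module.Basis (Fin n) k V) (σ : Equiv.Perm (Fin n))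
    (p q : StepFlag k V n) : (p, q) ∈ (permOrbit b σ).orbit ↔ RelPos σ p q := by
  rw [permOrbit, mem_orbit_pairOrbit]
  constructor
  · rintro ⟨g, h1, h2⟩
    refine ⟨b.map (LinearMap.GeneralLinearGroup.generalLinearEquiv k V g), ?_, ?_⟩
    · exact (smul_ofBasis g (b.reindex σ)).symm.trans h1
    · exact (smul_ofBasis g b).symm.trans h2
  · rintro ⟨v, rfl, rfl⟩
    have hv : b.map (LinearMap.GeneralLinearGroup.generalLinearEquiv k V
        (LinearMap.GeneralLinearGroup.ofLinearEquiv (b.equiv v (Equiv.refl _)))) = v := by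
      ext j
      exact (b.equiv_apply j v (Equiv.refl _))
    refine ⟨LinearMap.GeneralLinearGroup.ofLinearEquiv (b.equiv v (Equiv.refl _)), ?_, ?_⟩
    · refine (smul_ofBasis _ (b.reindex σ)).trans (congrArg ofBasis ?_)
      conv_rhs => rw [← hv]
      rfl
    · exact (smul_ofBasis _ b).trans (congrArg ofBasis hv)

theorem pairOrbit_eq_permOrbit (b : Module.Basis (Fin n) k V) {σ : Equiv.Perm (Fin n)}
    {p q : StepFlag k V n} (h : RelPos σ p q) : pairOrbit (p, q) = permOrbit b σ :=
  MulAction.orbitRel.Quotient.mem_orbit.1 ((mem_permOrbit_iff b σ p q).2 h)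

theorem permOrbit_injective (b : Module.Basis (Fin n) k V) :
    Function.Injective (permOrbit b) := by
  intro σ τ h
  have h1 : RelPos σ (ofBasis (b.reindex σ)) (ofBasis b) := ⟨b, rfl, rfl⟩
  have h2 := (mem_permOrbit_iff b σ _ _).2 h1
  rw [h, mem_permOrbit_iff] at h2
  exact h1.unique h2

theorem mem_orbitProduct_iff (b : Module.Basis (Fin n) k V) (σ τ : Equiv.Perm (Fin n))
    (p q : StepFlag k V n) : (p, q) ∈ orbitProduct (permOrbit b σ) (permOrbit b τ) ↔
      ∃ f, RelPos σ p f ∧ RelPos τ f q := by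
  simp only [orbitProduct, Set.mem_ofPred_eq, mem_permOrbit_iff]

/-- The open set bounds every intersection dimension above by the rank of m. On S(σ, τ) the opposite
bounds hold, so the ranks agree and determine the position. -/
theorem IsDemazureProduct.isOpenOrbitIn [Module.Finite k V] {σ τ m : Equiv.Perm (Fin n)}
    (b : Module.Basis (Fin n) k V) (h : IsDemazureProduct k V σ τ m) :
    IsOpenOrbitIn (permOrbit b m) (orbitProduct (permOrbit b σ) (permOrbit b τ)) := by
  let _ := zariskiFlagPairs k V n
  refine ⟨⋂ a : Fin (n + 1), ⋂ c : Fin (n + 1),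
    {p | Module.finrank k (p.1.space a ⊓ p.2.space c : Submodule k V) ≤ permRank m a c},
    isOpen_iInter_of_finite fun a => isOpen_iInter_of_finite fun c =>
      isOpen_finrank_inf_le a c _, ?_⟩
  ext ⟨p, q⟩
  rw [mem_permOrbit_iff, Set.mem_inter_iff, mem_orbitProduct_iff]
  simp only [Set.mem_iInter, Set.mem_ofPred_eq]
  constructor
  · intro hpq
    refine ⟨fun a c => (hpq.finrank_inf a c).le, ?_⟩
    -- One pair in position m lies in S; all others do because S is stable under GL(V), the middle
    -- flag being transported along.
    obtain ⟨p₁, p₂, p₃, h₁, h₂, h₃⟩ := h.1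
    have h4 : (p₁, p₃) ∈ (pairOrbit (p, q)).orbit := by
      rw [pairOrbit_eq_permOrbit b hpq, mem_permOrbit_iff]
      exact h₃
    obtain ⟨g, rfl, rfl⟩ := mem_orbit_pairOrbit.1 h4
    refine ⟨g⁻¹ • p₂, ?_, ?_⟩
    · rw [← mem_permOrbit_iff b, ← smul_mem_orbit_iff _ g, smul_inv_smul, mem_permOrbit_iff]
      exact h₁
    · rw [← mem_permOrbit_iff b, ← smul_mem_orbit_iff _ g, smul_inv_smul, mem_permOrbit_iff]
      exact h₂
  · rintro ⟨hle, f, h₁, h₂⟩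
    obtain ⟨ρ, hρ⟩ := RelPos.exists_of_isComplete h₁.isComplete_left h₂.isComplete_right
    have : ρ = m := permRank_injective fun a c ha hc => by
      have h3 := hle ⟨a, by omega⟩ ⟨c, by omega⟩
      have h4 := h.2 _ _ _ h₁ h₂ ⟨a, by omega⟩ ⟨c, by omega⟩
      rw [hρ.finrank_inf] at h3 h4
      exact le_antisymm h3 h4
    exact this ▸ hρ

/-- On a line through two elements of the stabiliser of `f`, almost all points lie in it. -/
theorem smul_eq_of_line [Module.Finite k V] {f : StepFlag k V n}
    {g h u : LinearMap.GeneralLinearGroup k V} (hg : g • f = f) (hh : h • f = f) {t : k}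
    (hu : (u : Module.End k V) = g + t • ((h : Module.End k V) - g)) : u • f = f := by
  ext1
  funext a
  rw [smul_space]
  refine Submodule.eq_of_le_of_finrank_eq ?_ (finrank_map_generalLinear u _)
  rintro _ ⟨x, hx, rfl⟩
  have hgx : (g : Module.End k V) x ∈ f.space a := by
    have h1 : (g : Module.End k V) x ∈ (g • f).space a := ⟨x, hx, rfl⟩
    rwa [hg] at h1
  have hhx : (h : Module.End k V) x ∈ f.space a := by
    have h1 : (h : Module.End k V) x ∈ (h • f).space a := ⟨x, hx, rfl⟩
    rwa [hh] at h1
  rw [hu]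
  exact add_mem hgx (Submodule.smul_mem _ _ (sub_mem hhx hgx))

/-- Two orbits that are open in `S(σ, τ)` coincide. -/
theorem isOpenOrbitIn_unique [Infinite k] (b : Module.Basis (Fin n) k V)
    (σ τ : Equiv.Perm (Fin n)) {c d : FlagPairOrbit k V n}
    (hc : IsOpenOrbitIn c (orbitProduct (permOrbit b σ) (permOrbit b τ)))
    (hd : IsOpenOrbitIn d (orbitProduct (permOrbit b σ) (permOrbit b τ))) : c = d := by
  have : Module.Finite k V := Module.Finite.of_basis b
  obtain ⟨π, hπ⟩ := ofBasis_mem_orbit b (b.reindex τ)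
  change π • ofBasis b = ofBasis (b.reindex τ) at hπ
  set S := orbitProduct (permOrbit b σ) (permOrbit b τ) with hS
  set X := ofBasis (b.reindex σ)
  set Y := π⁻¹ • ofBasis b with hY
  -- The Borel subgroup fixing `ofBasis b` parametrises S up to GL(V): the middle flag is normalised
  -- to `ofBasis b` and the first to X, and then γ Y runs through the possible third flags.
  have hpoint : ∀ γ : LinearMap.GeneralLinearGroup k V, γ • ofBasis b = ofBasis b →
      (X, γ • Y) ∈ S := by
    intro γ hγ
    refine (mem_orbitProduct_iff _ _ _ _ _).2 ⟨ofBasis b, ⟨b, rfl, rfl⟩, ?_⟩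
    rw [← mem_permOrbit_iff b, ← hγ, smul_mem_orbit_iff, ← smul_mem_orbit_iff _ π, hπ, hY,
      smul_inv_smul, mem_permOrbit_iff]
    exact ⟨b, rfl, rfl⟩
  have hrep : ∀ e : FlagPairOrbit k V n, e.orbit ⊆ S →
      ∃ γ : LinearMap.GeneralLinearGroup k V, γ • ofBasis b = ofBasis b ∧
        (X, γ • Y) ∈ e.orbit := by
    intro e he
    obtain ⟨⟨p, q⟩, hpq⟩ := orbit_nonempty e
    obtain ⟨f, h1, h2⟩ := he hpq
    obtain ⟨g, h3, h4⟩ := mem_orbit_pairOrbit.1 h1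
    obtain ⟨h, h5, h6⟩ := mem_orbit_pairOrbit.1 h2
    simp only at h3 h4 h5 h6
    refine ⟨g⁻¹ * h * π, ?_, ?_⟩
    · rw [mul_smul, mul_smul, hπ, h5, ← h4, inv_smul_smul]
    · rw [← smul_mem_orbit_iff _ g, h3, hY, mul_smul, smul_inv_smul, mul_smul, smul_inv_smul, h6]
      exact hpq
  obtain ⟨U, hU, hcU⟩ := hc
  obtain ⟨U', hU', hdU⟩ := hd
  obtain ⟨γ, hγ, hγc⟩ := hrep c (hcU ▸ Set.inter_subset_right)
  obtain ⟨δ, hδ, hδd⟩ := hrep d (hdU ▸ Set.inter_subset_right)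
  have hγU : ((1 : LinearMap.GeneralLinearGroup k V) • X, γ • Y) ∈ U := by
    rw [one_smul]; exact (hcU ▸ hγc : _ ∈ U ∩ S).1
  have hδU : ((1 : LinearMap.GeneralLinearGroup k V) • X, δ • Y) ∈ U' := by
    rw [one_smul]; exact (hdU ▸ hδd : _ ∈ U' ∩ S).1
  obtain ⟨P, hP, hP'⟩ := exists_polynomial_of_isOpen hU X Y hγU
  obtain ⟨Q, hQ, hQ'⟩ := exists_polynomial_of_isOpen hU' X Y hδU
  let x : Module.End k V × Module.End k V := (1, (γ : Module.End k V))
  let y : Module.End k V × Module.End k V := (1, (δ : Module.End k V))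
  obtain ⟨P₁, hP₁⟩ := exists_eval_line P x y
  obtain ⟨Q₁, hQ₁⟩ := exists_eval_line Q x y
  obtain ⟨D, hD⟩ := exists_eval_det_line b (γ : Module.End k V) (δ : Module.End k V)
  -- On the line from γ to δ, the first open condition holds at t = 0, the second at t = 1, and the
  -- determinant is nonzero at t = 0. No factor vanishes identically, so some t satisfies all three.
  have hne : P₁ * Q₁ * D ≠ 0 := by
    refine mul_ne_zero (mul_ne_zero ?_ ?_) ?_
    · rintro rfl
      refine hP ?_
      have := hP₁ 0
      rw [zero_smul, add_zero, Polynomial.eval_zero] at this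
      exact this.symm
    · rintro rfl
      refine hQ ?_
      have := hQ₁ 1
      rw [one_smul, add_sub_cancel, Polynomial.eval_zero] at this
      exact this.symm
    · rintro rfl
      have := hD 0
      rw [zero_smul, add_zero, Polynomial.eval_zero] at this
      exact (γ.isUnit.map (LinearMap.det : Module.End k V →* k)).ne_zero this.symm
  obtain ⟨t, ht⟩ : ∃ t, (P₁ * Q₁ * D).eval t ≠ 0 := by
    by_contra! hcon
    exact hne (Polynomial.funext fun t => by rw [hcon t, Polynomial.eval_zero])
  rw [Polynomial.eval_mul, Polynomial.eval_mul, hP₁, hQ₁, hD] at ht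
  obtain ⟨u, hu⟩ := LinearMap.isUnit_iff_isUnit_det _ |>.2
    (isUnit_iff_ne_zero.2 (right_ne_zero_of_mul ht))
  have hline : x + t • (y - x) = (((1 : LinearMap.GeneralLinearGroup k V) : Module.End k V),
      (u : Module.End k V)) := by
    rw [hu]
    simp [x, y]
  rw [hline] at ht
  have hu' := smul_eq_of_line hγ hδ hu
  have h1 := hP' 1 u (left_ne_zero_of_mul (left_ne_zero_of_mul ht))
  have h2 := hQ' 1 u (right_ne_zero_of_mul (left_ne_zero_of_mul ht))
  rw [one_smul] at h1 h2
  have h3 : (X, u • Y) ∈ c.orbit := hcU ▸ ⟨h1, hpoint u hu'⟩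
  have h4 : (X, u • Y) ∈ d.orbit := hdU ▸ ⟨h2, hpoint u hu'⟩
  exact (MulAction.orbitRel.Quotient.mem_orbit.1 h3).symm.trans
    (MulAction.orbitRel.Quotient.mem_orbit.1 h4)

theorem IsDemazureProduct.existsUnique_isOpenOrbitIn [Infinite k] {σ τ m : Equiv.Perm (Fin n)}
    (b : Module.Basis (Fin n) k V) (h : IsDemazureProduct k V σ τ m) :
    (orbitProduct (permOrbit b σ) (permOrbit b τ)).Nonempty ∧
      ∃! c, IsOpenOrbitIn c (orbitProduct (permOrbit b σ) (permOrbit b τ)) := by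
  have : Module.Finite k V := Module.Finite.of_basis b
  obtain ⟨p₁, p₂, p₃, h₁, h₂, -⟩ := h.1
  exact ⟨⟨(p₁, p₃), (mem_orbitProduct_iff _ _ _ _ _).2 ⟨p₂, h₁, h₂⟩⟩, permOrbit b m,
    h.isOpenOrbitIn b, fun c hc => isOpenOrbitIn_unique b σ τ hc (h.isOpenOrbitIn b)⟩

theorem IsDemazureProduct.basisElt_mul [Infinite k] {σ τ m : Equiv.Perm (Fin n)}
    (b : Module.Basis (Fin n) k V) (h : IsDemazureProduct k V σ τ m) :
    basisElt (permOrbit b σ) * basisElt (permOrbit b τ) = basisElt (permOrbit b m) := by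
  have : Module.Finite k V := Module.Finite.of_basis b
  have hex := h.existsUnique_isOpenOrbitIn b
  rw [_root_.basisElt_mul, starBasis, dif_pos hex]
  exact congrArg _ (isOpenOrbitIn_unique b σ τ hex.2.choose_spec.1 (h.isOpenOrbitIn b))

theorem existsUnique_isOpenOrbitIn_of_isComplete [Infinite k] (b : Module.Basis (Fin n) k V)
    {f₁ f₂ f₃ f₄ : StepFlag k V n} (h₁ : f₁.IsComplete) (h₂ : f₂.IsComplete) (h₃ : f₃.IsComplete)
    (h₄ : f₄.IsComplete) :
    (orbitProduct (pairOrbit (f₁, f₂)) (pairOrbit (f₃, f₄))).Nonempty ∧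
      ∃! c, IsOpenOrbitIn c (orbitProduct (pairOrbit (f₁, f₂)) (pairOrbit (f₃, f₄))) := by
  have : Module.Finite k V := Module.Finite.of_basis b
  obtain ⟨σ, hσ⟩ := RelPos.exists_of_isComplete h₁ h₂
  obtain ⟨τ, hτ⟩ := RelPos.exists_of_isComplete h₃ h₄
  rw [pairOrbit_eq_permOrbit b hσ, pairOrbit_eq_permOrbit b hτ]
  obtain ⟨m, hm⟩ := IsDemazureProduct.exists_demazure b σ τ
  exact hm.existsUnique_isOpenOrbitIn b

end OpenOrbit

/-! ### Normal form words and the upper bound on the dimension. -/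

section NormalForm

variable {R : Type*} [Ring R]

/-- The product `T j * T (j + 1) * ⋯ * T (j + l - 1)`. -/
def chainProd (T : ℕ → R) : ℕ → ℕ → R
  | _, 0 => 1
  | j, l + 1 => T j * chainProd T (j + 1) l

/-- The relations of the `0`-Hecke algebra for the generators `T 0, …, T (N - 1)`. -/
structure IsZeroHeckeFamily (T : ℕ → R) (N : ℕ) : Prop where
  quad : ∀ i < N, T i * T i = -T i
  braid : ∀ i, i + 1 < N → T i * T (i + 1) * T i = T (i + 1) * T i * T (i + 1)
  comm : ∀ i j, i < N → j < N → i + 1 < j → T i * T j = T j * T i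

open Classical in
/-- The normal form words in the generators `T 0, …, T (m - 1)`. -/
def normalWords (T : ℕ → R) : ℕ → Finset R
  | 0 => {1}
  | m + 1 => Finset.image₂ (fun l x => chainProd T (m + 1 - l) l * x) (Finset.range (m + 2))
      (normalWords T m)

theorem card_normalWords_le (T : ℕ → R) (m : ℕ) : (normalWords T m).card ≤ (m + 1).factorial := by
  induction m with
  | zero => simp [normalWords]
  | succ m ih =>
    classical
    rw [normalWords, Nat.factorial_succ]
    refine (Finset.card_image₂_le _ _ _).trans ?_
    rw [Finset.card_range]
    exact Nat.mul_le_mul_left _ ih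

theorem one_mem_normalWords (T : ℕ → R) (m : ℕ) : (1 : R) ∈ normalWords T m := by
  induction m with
  | zero => simp [normalWords]
  | succ m ih =>
    classical
    exact Finset.mem_image₂.2 ⟨0, by simp, 1, ih, by simp [chainProd]⟩

namespace IsZeroHeckeFamily

variable {T : ℕ → R} {N : ℕ}

theorem mul_chainProd_of_lt (hT : IsZeroHeckeFamily T N) {i j l : ℕ} (hij : i + 1 < j)
    (hl : j + l ≤ N) : T i * chainProd T j l = chainProd T j l * T i := by
  induction l generalizing j with
  | zero => simp [chainProd]
  | succ l ih =>
    rw [chainProd, ← mul_assoc, hT.comm i j (by omega) (by omega) hij, mul_assoc,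
      ih (j := j + 1) (by omega) (by omega), mul_assoc]

/-- The generator commutes with the chain up to T i T (i + 1), where the braid relation lowers its
index by one; the lowered generator commutes with the rest. -/
theorem succ_mul_chainProd (hT : IsZeroHeckeFamily T N) {i j l : ℕ} (hij : j ≤ i)
    (hi : i + 1 < j + l) (hl : j + l ≤ N) :
    T (i + 1) * chainProd T j l = chainProd T j l * T i := by
  induction l generalizing j with
  | zero => omega
  | succ l ih =>
    rcases hij.eq_or_lt with rfl | hij
    · obtain ⟨l, rfl⟩ : ∃ l', l = l' + 1 := ⟨l - 1, by omega⟩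
      rw [chainProd, chainProd, ← mul_assoc, ← mul_assoc, ← hT.braid j (by omega), mul_assoc,
        hT.mul_chainProd_of_lt (by omega) (by omega)]
      simp only [mul_assoc]
    · rw [chainProd, ← mul_assoc, ← hT.comm j (i + 1) (by omega) (by omega) (by omega), mul_assoc,
        ih (j := j + 1) hij (by omega) (by omega), mul_assoc]

/-- A word is a chain ending at T m times a word in the earlier generators. A generator meeting the
chain is absorbed by it or passes through and acts on the shorter word, so induction applies. -/
theorem mul_mem_span_normalWords [Algebra ℂ R] (hT : IsZeroHeckeFamily T N) {m i : ℕ} (hm : m ≤ N) (hi : i < m)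
    {x : R} (hx : x ∈ Submodule.span ℂ (normalWords T m : Set R)) :
    T i * x ∈ Submodule.span ℂ (normalWords T m : Set R) := by
  induction m generalizing i x with
  | zero => omega
  | succ m ih =>
    classical
    have key : ∀ l ≤ m + 1, ∀ y ∈ Submodule.span ℂ (normalWords T m : Set R),
        chainProd T (m + 1 - l) l * y ∈ Submodule.span ℂ (normalWords T (m + 1) : Set R) := by
      intro l hl y hy
      induction hy using Submodule.span_induction with
      | mem y hy =>
        exact Submodule.subset_span (Finset.mem_coe.2
          (Finset.mem_image₂.2 ⟨l, by rw [Finset.mem_range]; omega, y, hy, rfl⟩))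
      | zero => rw [mul_zero]; exact zero_mem _
      | add y z _ _ hy hz => rw [mul_add]; exact add_mem hy hz
      | smul c y _ hy => rw [mul_smul_comm]; exact Submodule.smul_mem _ _ hy
    induction hx using Submodule.span_induction with
    | zero => rw [mul_zero]; exact zero_mem _
    | add y z _ _ hy hz => rw [mul_add]; exact add_mem hy hz
    | smul c y _ hy => rw [mul_smul_comm]; exact Submodule.smul_mem _ _ hy
    | mem x hx =>
      obtain ⟨l, hl, y, hy, rfl⟩ := Finset.mem_image₂.1 (Finset.mem_coe.1 hx)
      rw [Finset.mem_range] at hl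
      have hy' : y ∈ Submodule.span ℂ (normalWords T m : Set R) := Submodule.subset_span hy
      -- With respect to the first index m + 1 - l of the chain, T i commutes past it, lengthens it
      -- by one, is absorbed with a sign, or passes through as T (i - 1).
      have hcases : i + 1 < m + 1 - l ∨ i + 1 = m + 1 - l ∨ i = m + 1 - l ∨ m + 1 - l < i := by
        omega
      rcases hcases with h | h | h | h
      · rw [← mul_assoc, hT.mul_chainProd_of_lt h (by omega), mul_assoc]
        exact key l (by omega) _ (ih (by omega) (by omega) hy')
      · have := key (l + 1) (by omega) y hy'
        rwa [show m + 1 - (l + 1) = i by omega, chainProd, h, mul_assoc] at this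
      · obtain ⟨l, rfl⟩ : ∃ l', l = l' + 1 := ⟨l - 1, by omega⟩
        have := key (l + 1) (by omega) y hy'
        rw [← h, chainProd] at this ⊢
        rw [mul_assoc (T i) _ y, ← mul_assoc, hT.quad i (by omega), neg_mul, ← mul_assoc]
        exact neg_mem this
      · obtain ⟨i, rfl⟩ : ∃ i', i = i' + 1 := ⟨i - 1, by omega⟩
        rw [← mul_assoc, hT.succ_mul_chainProd (by omega) (by omega) (by omega), mul_assoc]
        exact key l (by omega) _ (ih (by omega) (by omega) hy')

end IsZeroHeckeFamily

end NormalForm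

/-! ### The presented 0-Hecke algebra. -/

namespace ZeroHecke

variable {n : ℕ}

theorem gen_mul_self (i : Fin (n - 1)) : (gen i * gen i : ZeroHecke n) = -gen i := by
  rw [gen, ← map_mul, RingQuot.mkAlgHom_rel ℂ (ZeroHeckeRel.quad i), map_neg]

theorem gen_braid (i j : Fin (n - 1)) (h : (j : ℕ) = i + 1) :
    (gen i * gen j * gen i : ZeroHecke n) = gen j * gen i * gen j := by
  simp only [gen, ← map_mul]
  exact RingQuot.mkAlgHom_rel ℂ (ZeroHeckeRel.braid i j h)

theorem gen_comm (i j : Fin (n - 1)) (h : (i : ℕ) + 1 < j ∨ (j : ℕ) + 1 < i) :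
    (gen i * gen j : ZeroHecke n) = gen j * gen i := by
  simp only [gen, ← map_mul]
  exact RingQuot.mkAlgHom_rel ℂ (ZeroHeckeRel.comm i j h)

/-- The generators numbered by all natural numbers, with zeros past the end. -/
def genNat (n i : ℕ) : ZeroHecke n := if h : i < n - 1 then gen ⟨i, h⟩ else 0

theorem genNat_of_lt {i : ℕ} (h : i < n - 1) : genNat n i = gen ⟨i, h⟩ := dif_pos h

theorem isZeroHeckeFamily_genNat : IsZeroHeckeFamily (genNat n) (n - 1) where
  quad i hi := by rw [genNat_of_lt hi, gen_mul_self]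
  braid i hi := by
    rw [genNat_of_lt hi, genNat_of_lt (by omega : i < n - 1)]
    exact gen_braid _ _ rfl
  comm i j hi hj h := by
    rw [genNat_of_lt hi, genNat_of_lt hj]
    exact gen_comm _ _ (Or.inl h)

/-- The span contains 1 and is stable under left multiplication by the generators, hence by the
whole algebra. -/
theorem span_normalWords : Submodule.span ℂ (normalWords (genNat n) (n - 1) : Set (ZeroHecke n)) =
    ⊤ := by
  rw [eq_top_iff]
  rintro x -
  obtain ⟨a, rfl⟩ := RingQuot.mkAlgHom_surjective ℂ (ZeroHeckeRel n) x
  have key : ∀ y ∈ Submodule.span ℂ (normalWords (genNat n) (n - 1) : Set (ZeroHecke n)),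
      RingQuot.mkAlgHom ℂ (ZeroHeckeRel n) a * y ∈
        Submodule.span ℂ (normalWords (genNat n) (n - 1) : Set (ZeroHecke n)) := by
    induction a using FreeAlgebra.induction with
    | grade0 c =>
      intro y hy
      rw [AlgHom.commutes, ← Algebra.smul_def]
      exact Submodule.smul_mem _ _ hy
    | grade1 i =>
      intro y hy
      have := isZeroHeckeFamily_genNat.mul_mem_span_normalWords le_rfl i.2 hy
      rwa [genNat_of_lt i.2] at this
    | mul a a' ha ha' =>
      intro y hy
      rw [map_mul, mul_assoc]
      exact ha _ (ha' _ hy)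
    | add a a' ha ha' =>
      intro y hy
      rw [map_add, add_mul]
      exact add_mem (ha _ hy) (ha' _ hy)
  have := key 1 (Submodule.subset_span (one_mem_normalWords _ _))
  rwa [mul_one] at this

instance : Module.Finite ℂ (ZeroHecke n) := ⟨⟨_, span_normalWords⟩⟩

theorem finrank_le (hn : 1 ≤ n) : Module.finrank ℂ (ZeroHecke n) ≤ n.factorial := by
  rw [← finrank_top, ← span_normalWords]
  refine (finrank_span_finset_le_card _).trans ?_
  have := card_normalWords_le (genNat n) (n - 1)
  rwa [Nat.sub_add_cancel hn] at this

theorem exists_algHom {B : Type*} [Ring B] [Algebra ℂ B] (t : Fin (n - 1) → B)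
    (quad : ∀ i, t i * t i = t i)
    (braid : ∀ i j : Fin (n - 1), (j : ℕ) = i + 1 → t i * t j * t i = t j * t i * t j)
    (comm : ∀ i j : Fin (n - 1), (i : ℕ) + 1 < j ∨ (j : ℕ) + 1 < i → t i * t j = t j * t i) :
    ∃ φ : ZeroHecke n →ₐ[ℂ] B, ∀ i, φ (gen i) = -t i := by
  have hrel : ∀ ⦃x y⦄, ZeroHeckeRel n x y →
      FreeAlgebra.lift ℂ (fun i => -t i) x = FreeAlgebra.lift ℂ (fun i => -t i) y := by
    intro x y hxy
    induction hxy with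
    | quad i =>
      rw [map_neg, map_mul, FreeAlgebra.lift_ι_apply, neg_mul_neg, neg_neg, quad]
    | braid i j h =>
      simp only [map_mul, FreeAlgebra.lift_ι_apply, neg_mul, mul_neg, neg_neg, braid i j h]
    | comm i j h =>
      simp only [map_mul, FreeAlgebra.lift_ι_apply, neg_mul_neg, comm i j h]
  exact ⟨RingQuot.liftAlgHom ℂ ⟨FreeAlgebra.lift ℂ _, hrel⟩, fun i => by
    rw [gen, RingQuot.liftAlgHom_mkAlgHom_apply, FreeAlgebra.lift_ι_apply]⟩

end ZeroHecke

/-! ### Relations among Demazure steps and the comparison isomorphism. -/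

section DemazureSteps

variable {n : ℕ}

theorem demazureStep_one (i : Fin (n - 1)) : demazureStep i 1 = adjSwap i := by
  rw [demazureStep_of_isAscent (isAscent_one i), mul_one]

theorem adjSwap_braid (i j : Fin (n - 1)) (h : (j : ℕ) = i + 1) :
    adjSwap i * (adjSwap j * adjSwap i) = adjSwap j * (adjSwap i * adjSwap j) := by
  have hij : highIdx i = lowIdx j := Fin.ext h.symm
  have h1 := Equiv.swap_mul_swap_mul_swap (x := lowIdx i) (y := lowIdx j) (z := highIdx j)
    (hij ▸ lowIdx_ne_highIdx i) (by simp [Fin.ext_iff, h]; omega)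
  have h2 := Equiv.swap_mul_swap_mul_swap (x := highIdx j) (y := lowIdx j) (z := lowIdx i)
    (lowIdx_ne_highIdx j).symm (by simp [Fin.ext_iff, h]; omega)
  rw [← mul_assoc, ← mul_assoc, adjSwap, adjSwap, hij, h1, Equiv.swap_comm (highIdx j), ← h2,
    Equiv.swap_comm (lowIdx j) (lowIdx i), Equiv.swap_comm (highIdx j)]

/-- Every step on either side is an ascent, so both sides are ordinary products and the braid
relation in Sₙ applies. -/
theorem demazureStep_braid (i j : Fin (n - 1)) (h : (j : ℕ) = i + 1) :
    demazureStep i (demazureStep j (adjSwap i)) = demazureStep j (demazureStep i (adjSwap j)) := by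
  have hij : highIdx i = lowIdx j := Fin.ext h.symm
  have hi : adjSwap i (highIdx j) = highIdx j :=
    adjSwap_of_ne (by simp [Fin.ext_iff, h]; omega) (by simp [Fin.ext_iff, h])
  have hj : adjSwap j (lowIdx i) = lowIdx i :=
    adjSwap_of_ne (by simp [Fin.ext_iff, h]) (by simp [Fin.ext_iff, h]; omega)
  have h1 : IsAscent j (adjSwap i) := by
    rw [IsAscent, adjSwap_inv, ← hij, adjSwap_high, hi, Fin.lt_def, val_lowIdx, val_highIdx]
    omega
  have h2 : IsAscent i (adjSwap j) := by
    rw [IsAscent, adjSwap_inv, hij, adjSwap_low, hj, Fin.lt_def, val_lowIdx, val_highIdx]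
    omega
  have h3 : IsAscent i (adjSwap j * adjSwap i) := by
    rw [IsAscent, mul_inv_rev, adjSwap_inv, adjSwap_inv, Equiv.Perm.mul_apply,
      Equiv.Perm.mul_apply, hj, hij, adjSwap_low, adjSwap_low, hi, hij, Fin.lt_def, val_lowIdx,
      val_highIdx]
    omega
  have h4 : IsAscent j (adjSwap i * adjSwap j) := by
    rw [IsAscent, mul_inv_rev, adjSwap_inv, adjSwap_inv, Equiv.Perm.mul_apply,
      Equiv.Perm.mul_apply, hi, ← hij, adjSwap_high, hj, adjSwap_high, ← hij, Fin.lt_def,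
      val_lowIdx, val_highIdx]
    omega
  rw [demazureStep_of_isAscent h1, demazureStep_of_isAscent h2, demazureStep_of_isAscent h3,
    demazureStep_of_isAscent h4, adjSwap_braid i j h]

theorem isAscent_adjSwap_of_far {i j : Fin (n - 1)}
    (h : (i : ℕ) + 1 < j ∨ (j : ℕ) + 1 < i) : IsAscent i (adjSwap j) := by
  rw [IsAscent, adjSwap_inv, adjSwap_of_ne, adjSwap_of_ne, Fin.lt_def, val_lowIdx, val_highIdx]
  · omega
  all_goals
    simp only [ne_eq, Fin.ext_iff, val_lowIdx, val_highIdx]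
    omega

theorem demazureStep_comm (i j : Fin (n - 1)) (h : (i : ℕ) + 1 < j ∨ (j : ℕ) + 1 < i) :
    demazureStep i (adjSwap j) = demazureStep j (adjSwap i) := by
  rw [demazureStep_of_isAscent (isAscent_adjSwap_of_far h),
    demazureStep_of_isAscent (isAscent_adjSwap_of_far h.symm)]
  refine (Equiv.Perm.Disjoint.commute fun l => ?_).eq
  by_cases hl : adjSwap i l = l
  · exact Or.inl hl
  · refine Or.inr (adjSwap_of_ne ?_ ?_)
    all_goals
      rintro rfl
      refine hl (adjSwap_of_ne ?_ ?_)
      all_goals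
        simp only [ne_eq, Fin.ext_iff, val_lowIdx, val_highIdx]
        omega

/-- A ring with a `ℤ`-basis on which the simple transpositions act by Demazure products is, over
`ℂ`, the `0`-Hecke algebra. -/
theorem exists_zeroHecke_algEquiv (hn : 1 ≤ n) {A : Type*} [Ring A]
    (e : Module.Basis (Equiv.Perm (Fin n)) ℤ A) (h1 : e 1 = 1)
    (hstep : ∀ i τ, e (adjSwap i) * e τ = e (demazureStep i τ)) :
    ∃ φ : ZeroHecke n ≃ₐ[ℂ] ℂ ⊗[ℤ] A,
      ∀ i, φ (ZeroHecke.gen i) = -((1 : ℂ) ⊗ₜ[ℤ] e (adjSwap i)) := by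
  obtain ⟨φ, hφ⟩ := ZeroHecke.exists_algHom (fun i => ((1 : ℂ) ⊗ₜ[ℤ] e (adjSwap i) : ℂ ⊗[ℤ] A))
    (fun i => by
      rw [Algebra.TensorProduct.tmul_mul_tmul, hstep, mul_one, ← demazureStep_one,
        demazureStep_idem])
    (fun i j h => by
      rw [mul_assoc, mul_assoc]
      simp only [Algebra.TensorProduct.tmul_mul_tmul, hstep, demazureStep_braid i j h])
    (fun i j h => by
      simp only [Algebra.TensorProduct.tmul_mul_tmul, hstep, demazureStep_comm i j h])
  -- Along ascents a Demazure step is an ordinary product, so each e σ is a product of the images of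
  -- the negated generators.
  have hmem : ∀ σ, ((1 : ℂ) ⊗ₜ[ℤ] e σ : ℂ ⊗[ℤ] A) ∈ φ.range := by
    intro σ
    induction σ using perm_ascent_induction with
    | one => rw [h1]; exact one_mem _
    | step i σ hi ih =>
      have h2 : ((1 : ℂ) ⊗ₜ[ℤ] e (adjSwap i) : ℂ ⊗[ℤ] A) ∈ φ.range :=
        ⟨-ZeroHecke.gen i, by
          change φ (-ZeroHecke.gen i) = _
          rw [map_neg, hφ, neg_neg]⟩
      have h3 := mul_mem h2 ih
      rwa [Algebra.TensorProduct.tmul_mul_tmul, hstep, mul_one, demazureStep_of_isAscent hi] at h3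
  have hsurj : Function.Surjective φ := by
    rw [← AlgHom.range_eq_top, ← Algebra.toSubmodule_eq_top, eq_top_iff,
      ← (Algebra.TensorProduct.basis ℂ e).span_eq, Submodule.span_le]
    rintro _ ⟨σ, rfl⟩
    rw [Algebra.TensorProduct.basis_apply]
    exact hmem σ
  have : Module.Finite ℂ (ℂ ⊗[ℤ] A) := Module.Finite.of_basis (Algebra.TensorProduct.basis ℂ e)
  have hcard : Module.finrank ℂ (ℂ ⊗[ℤ] A) = n.factorial := by
    rw [Module.finrank_eq_card_basis (Algebra.TensorProduct.basis ℂ e), Fintype.card_perm,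
      Fintype.card_fin]
  -- Surjectivity bounds the dimension of the source below by n!, the normal forms bound it above by
  -- n!; equal finite dimensions make the surjection injective.
  have hrank : Module.finrank ℂ (ZeroHecke n) = Module.finrank ℂ (ℂ ⊗[ℤ] A) :=
    le_antisymm (hcard ▸ ZeroHecke.finrank_le hn)
      (LinearMap.finrank_le_finrank_of_surjective (f := φ.toLinearMap) hsurj)
  have hinj : Function.Injective φ :=
    (LinearMap.injective_iff_surjective_of_finrank_eq_finrank (f := φ.toLinearMap) hrank).2 hsurj
  exact ⟨AlgEquiv.ofBijective φ ⟨hinj, hsurj⟩, hφ⟩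

end DemazureSteps

/-! ### The basis of H₀(n), its multiplication and associativity. -/

section Corner

variable {k V : Type*} [Field k] [AddCommGroup V] [Module k V] {n : ℕ}
  (b : Module.Basis (Fin n) k V)

theorem tElt_eq_permElt (i : Fin (n - 1)) : tElt b i = permElt b (adjSwap i) := rfl

theorem permElt_one : permElt b 1 = 1 := by
  refine Subtype.ext ?_
  change basisElt (permOrbit b 1) = basisElt _
  rw [permOrbit, Equiv.Perm.one_def, Module.Basis.reindex_refl]

theorem IsDemazureProduct.permElt_mul [Infinite k] {σ τ m : Equiv.Perm (Fin n)}
    (h : IsDemazureProduct k V σ τ m) : permElt b σ * permElt b τ = permElt b m :=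
  Subtype.ext (h.basisElt_mul b)

theorem permElt_adjSwap_mul [Infinite k] (i : Fin (n - 1)) (τ : Equiv.Perm (Fin n)) :
    permElt b (adjSwap i) * permElt b τ = permElt b (demazureStep i τ) := by
  have : Module.Finite k V := Module.Finite.of_basis b
  have h := (IsDemazureProduct.one_left b (τ := τ)).adjSwap_mul (isAscent_one i)
  rw [mul_one] at h
  exact h.permElt_mul b

/-- This drops the ascent hypothesis of `adjSwap_mul`. At a descent σ is s_i times a shorter
permutation, so m is itself the result of a step at i and is fixed by another. -/
theorem IsDemazureProduct.demazureStep_left [Module.Finite k V] {σ τ m : Equiv.Perm (Fin n)}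
    (h : IsDemazureProduct k V σ τ m) (i : Fin (n - 1)) :
    IsDemazureProduct k V (demazureStep i σ) τ (demazureStep i m) := by
  by_cases hi : IsAscent i σ
  · rw [demazureStep_of_isAscent hi]
    exact h.adjSwap_mul hi
  · rw [demazureStep_of_not_isAscent hi]
    have hbasis : ∃ b : Module.Basis (Fin n) k V, True := by
      obtain ⟨_, _, _, ⟨v, -, -⟩, -⟩ := h.1
      exact ⟨v, trivial⟩
    obtain ⟨v, -⟩ := hbasis
    obtain ⟨m', hm'⟩ := IsDemazureProduct.exists_demazure v (adjSwap i * σ) τ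
    have h1 := hm'.adjSwap_mul (isAscent_adjSwap_mul.2 hi)
    rw [adjSwap_mul_cancel] at h1
    rw [h.unique h1, demazureStep_idem, ← h.unique h1]
    exact h

theorem permElt_mul_assoc [Infinite k] (σ τ ρ : Equiv.Perm (Fin n)) :
    permElt b σ * permElt b τ * permElt b ρ = permElt b σ * (permElt b τ * permElt b ρ) := by
  have : Module.Finite k V := Module.Finite.of_basis b
  obtain ⟨y, hy⟩ := IsDemazureProduct.exists_demazure b τ ρ
  -- Stated for Demazure products, associativity passes from σ to s_i σ by applying the same step to
  -- x and z. Since x may have a descent at i, the middle product needs `demazureStep_left`.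
  suffices h : ∃ x z, IsDemazureProduct k V σ τ x ∧ IsDemazureProduct k V x ρ z ∧
      IsDemazureProduct k V σ y z by
    obtain ⟨x, z, h1, h2, h3⟩ := h
    rw [h1.permElt_mul b, h2.permElt_mul b, hy.permElt_mul b, h3.permElt_mul b]
  induction σ using perm_ascent_induction with
  | one => exact ⟨τ, y, .one_left b, hy, .one_left b⟩
  | step i σ hi ih =>
    obtain ⟨x, z, h1, h2, h3⟩ := ih
    exact ⟨_, _, h1.adjSwap_mul hi, h2.demazureStep_left i, h3.adjSwap_mul hi⟩

/-- The projection `x ↦ k_d x k_d` onto the corner. -/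
def cornerProj : GenericAlgebra k V n →+ GeomHeckeZero b where
  toFun y := ⟨idemElt (ofBasis b) * y * idemElt (ofBasis b), y, rfl⟩
  map_zero' := Subtype.ext (by
    change idemElt (ofBasis b) * 0 * idemElt (ofBasis b) = 0
    rw [mul_zero, zero_mul])
  map_add' x y := Subtype.ext (by
    change idemElt (ofBasis b) * (x + y) * idemElt (ofBasis b) =
      idemElt (ofBasis b) * x * idemElt (ofBasis b) + idemElt (ofBasis b) * y * idemElt (ofBasis b)
    rw [mul_add, add_mul])

/-- Compressing by k_d kills an orbit unless both flags are conjugate to the standard complete flag;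
the surviving orbits are given by permutations. -/
theorem mem_span_range_permElt (x : GeomHeckeZero b) :
    x ∈ Submodule.span ℤ (Set.range (permElt b)) := by
  have : Module.Finite k V := Module.Finite.of_basis b
  obtain ⟨y, rfl⟩ : ∃ y, cornerProj b y = x := by
    obtain ⟨_, y, rfl⟩ := x
    exact ⟨y, rfl⟩
  induction y using GenericAlgebra.induction with
  | zero => rw [map_zero]; exact zero_mem _
  | add y z hy hz => rw [map_add]; exact add_mem hy hz
  | neg y hy => rw [map_neg]; exact neg_mem hy
  | basis p =>
    by_cases h1 : p.1 ∈ MulAction.orbit (LinearMap.GeneralLinearGroup k V) (ofBasis b)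
    · by_cases h2 : p.2 ∈ MulAction.orbit (LinearMap.GeneralLinearGroup k V) (ofBasis b)
      · have hc : ∀ f ∈ MulAction.orbit (LinearMap.GeneralLinearGroup k V) (ofBasis b),
            f.IsComplete := by
          rintro _ ⟨g, rfl⟩
          change (g • ofBasis b).IsComplete
          rw [smul_ofBasis]
          exact ofBasis_isComplete _
        obtain ⟨σ, hσ⟩ := RelPos.exists_of_isComplete (hc _ h1) (hc _ h2)
        refine Submodule.subset_span ⟨σ, Subtype.ext ?_⟩
        change basisElt (permOrbit b σ) = idemElt (ofBasis b) * _ * idemElt (ofBasis b)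
        rw [idemElt_mul_basisElt _ _ h1, basisElt_mul_idemElt _ _ h2,
          ← pairOrbit_eq_permOrbit b hσ]
      · have : cornerProj b (basisElt (pairOrbit p)) = 0 := Subtype.ext (by
          change idemElt (ofBasis b) * _ * idemElt (ofBasis b) = 0
          rw [mul_idemElt_assoc, basisElt_mul_idemElt_zero _ _ h2, mul_zero])
        rw [this]
        exact zero_mem _
    · have : cornerProj b (basisElt (pairOrbit p)) = 0 := Subtype.ext (by
        change idemElt (ofBasis b) * _ * idemElt (ofBasis b) = 0
        rw [idemElt_mul_basisElt_zero _ _ h1, zero_mul])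
      rw [this]
      exact zero_mem _

theorem linearIndependent_permElt : LinearIndependent ℤ (permElt b) := by
  let f : GeomHeckeZero b →ₗ[ℤ] (FlagPairOrbit k V n →₀ ℤ) :=
    AddMonoidHom.toIntLinearMap (M := GeomHeckeZero b) (M₂ := FlagPairOrbit k V n →₀ ℤ)
      { toFun := fun x => x.1
        map_zero' := rfl
        map_add' := fun _ _ => rfl }
  refine LinearIndependent.of_comp f ?_
  exact (Finsupp.basisSingleOne (R := ℤ) (ι := FlagPairOrbit k V n)).linearIndependent.comp _
    (permOrbit_injective b)

/-- The elements `σ k_d` form a basis of `H₀(n)` over `ℤ`. -/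
def permBasis : Module.Basis (Equiv.Perm (Fin n)) ℤ (GeomHeckeZero b) :=
  Module.Basis.mk (linearIndependent_permElt b) fun x _ => mem_span_range_permElt b x

theorem permBasis_apply (σ : Equiv.Perm (Fin n)) : permBasis b σ = permElt b σ :=
  Module.Basis.mk_apply _ _ σ

theorem GeomHeckeZero.mul_assoc [Infinite k] (x y z : GeomHeckeZero b) :
    x * y * z = x * (y * z) := by
  induction mem_span_range_permElt b x using Submodule.span_induction with
  | zero => simp only [zero_mul]
  | add x x' _ _ h h' => simp only [add_mul, h, h']
  | smul c x _ h => simp only [smul_mul_assoc, h]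
  | mem x hx =>
    obtain ⟨σ, rfl⟩ := hx
    induction mem_span_range_permElt b y using Submodule.span_induction with
    | zero => simp only [zero_mul, mul_zero]
    | add y y' _ _ h h' => simp only [add_mul, mul_add, h, h']
    | smul c y _ h => simp only [smul_mul_assoc, mul_smul_comm, h]
    | mem y hy =>
      obtain ⟨τ, rfl⟩ := hy
      induction mem_span_range_permElt b z using Submodule.span_induction with
      | zero => simp only [mul_zero]
      | add z z' _ _ h h' => simp only [mul_add, h, h']
      | smul c z _ h => simp only [mul_smul_comm, h]
      | mem z hz =>
        obtain ⟨ρ, rfl⟩ := hz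
        exact permElt_mul_assoc b σ τ ρ

end Corner

end

theorem mainTheorem10 {k : Type*} [Field k] [IsAlgClosed k] {V : Type*} [AddCommGroup V]
    [Module k V] {n : ℕ} (hn : 1 ≤ n) (b : Module.Basis (Fin n) k V) :
    (∀ f₁ f₂ f₃ f₄ : StepFlag k V n,
      f₁.IsComplete → f₂.IsComplete → f₃.IsComplete → f₄.IsComplete →
      (orbitProduct (pairOrbit (f₁, f₂)) (pairOrbit (f₃, f₄))).Nonempty ∧
      ∃! c, IsOpenOrbitIn c (orbitProduct (pairOrbit (f₁, f₂)) (pairOrbit (f₃, f₄)))) ∧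
    ∃ hassoc : ∀ x y z : GeomHeckeZero b, x * y * z = x * (y * z),
      letI : Ring (GeomHeckeZero b) := GeomHeckeZero.ring b hassoc
      ∃ φ : ZeroHecke n ≃ₐ[ℂ] ℂ ⊗[ℤ] GeomHeckeZero b,
        ∀ i : Fin (n - 1), φ (ZeroHecke.gen i) = -((1 : ℂ) ⊗ₜ[ℤ] tElt b i) := by
  -- Infinitude of k supplies the nonroot in the uniqueness of the open orbit.
  have : Infinite k := IsAlgClosed.instInfinite
  refine ⟨fun f₁ f₂ f₃ f₄ h₁ h₂ h₃ h₄ => existsUnique_isOpenOrbitIn_of_isComplete b h₁ h₂ h₃ h₄,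
    GeomHeckeZero.mul_assoc b, ?_⟩
  let _ : Ring (GeomHeckeZero b) := GeomHeckeZero.ring b (GeomHeckeZero.mul_assoc b)
  obtain ⟨φ, hφ⟩ := exists_zeroHecke_algEquiv hn (A := GeomHeckeZero b) (permBasis b)
    ((permBasis_apply b 1).trans (permElt_one b)) fun i τ => by
      rw [permBasis_apply, permBasis_apply, permBasis_apply]
      exact permElt_adjSwap_mul b i τ
  refine ⟨φ, fun i => (hφ i).trans ?_⟩
  rw [permBasis_apply, tElt_eq_permElt]
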